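/- **Setting.** Let $V\hookrightarrow H\cong H^*\hookrightarrow V^*$ be a Gelfand triple of real Hilbert spaces, the embedding $V\hookrightarrow H$ being injective, dense, continuous and compact; $\|\cdot\|$ is the norm of $H$. Let $a\colon V\times V\to\mathbb R$ be a continuous bilinear form for which there are $\alpha_0>0$, $\omega_0\ge 0$ with $a(v,v)+\omega_0\|v\|^2\ge\alpha_0\|v\|_V^2$ for all $v\in V$, and let $A\colon V\to V^*$, $\langle Ay,v\rangle=a(y,v)$, $\langle A^*p,v\rangle=a(v,p)$. Let $(\omega,\varrho)$ be a measure space, $B\colon L^2(\omega)\to V^*$ linear and continuous with adjoint $B^*\colon V\to L^2(\omega)$, let $u_a,u_b\in L^\infty(\omega)$ with $u_a<u_b$ a.e., $y_0,y_d\in H$, $\delta_0>0$, and $I=(0,1)$. Put $U(0,1)=L^2(I;L^2(\omega))$ $(=L^2(I\times\omega))$ and $$U_{ad}(0,1)=\{u\in U(0,1): u_a\le u(t)\le u_b \text{ a.e. in }\omega,\text{ for a.e. }t\in I\}.$$ For $\nu>0$ and $u\in U(0,1)$ let $S(\nu,u)=y\in W(0,1)=H^1(I;V^*)\cap L^2(I;V)\subset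 C([0,1];H)$ be the unique solution of $$\partial_t y+\nu Ay=\nu Bu,\qquad y(0)=y_0 .$$ Let $f(\nu,u)=\|S(\nu,u)(1)-y_d\|-\delta_0$, let $\delta(\nu)=\inf_{u\in U_{ad}(0,1)}f(\nu,u)$ be the minimal distance value function, and let $\bar u(\nu)\subset U_{ad}(0,1)$ be the set of minimizers. For $y=S(\nu,u)$ with $y(1)\ne y_d$ let $p(\nu,u)=p\in W(0,1)$ be the solution of the adjoint equation $$-\partial_t p+\nu A^*p=0,\qquad p(1)=\frac{y(1)-y_d}{\|y(1)-y_d\|}.$$ **Hypotheses.** Let $\bar\nu>0$ be such that $\delta(\bar\nu)>-\delta_0$ and $\bar u(\bar\nu)=\{\bar u\}$ is a singleton, and suppose: 1. (growth) there is $c_0>0$ such that $\partial_uf(\bar\nu,\bar u)(u'-\bar u)\ge\bar\nu c_0\|u'-\bar u\|_{L^1(I\times\omega)}^2$ for all $u'\in U_{ad}(0,1)$ (in particular these $L^1$ norms are finite); 2. (stability of adjoint states) there are $0<\nu_{\min}<\bar\nu<\nu_{\max}$ and a constant $c'$ such that $$\|B^*(p(\nu_1,u)-p(\nu_2,u))\|_{L^\infty(I\times\omega)}\le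 c'|\nu_1-\nu_2|$$ for all $\nu_1,\nu_2\in[\nu_{\min},\nu_{\max}]$ and all $u\in U_{ad}(0,1)$ for which both adjoint states are defined; 3. $B\in\mathcal L(L^1(\omega),H)$, i.e. there is a bounded linear operator $L^1(\omega)\to H$ which coincides with $B$ on $L^1(\omega)\cap L^2(\omega)$. **Conclusion.** There are $r\in(0,\bar\nu)$ and $c>0$ such that $\delta(\cdot)$ has a left and a right derivative at every $\nu\in[\bar\nu-r,\bar\nu+r]$, is differentiable at $\bar\nu$, and, for all $\nu_1\in[\bar\nu-r,\bar\nu]$ and $\nu_2\in[\bar\nu,\bar\nu+r]$, $$|d_1-d_2|\le c\,|\nu_1-\nu_2|$$ whenever $d_1$ is the left or the right derivative of $\delta(\cdot)$ at $\nu_1$ and $d_2$ is the left or the right derivative of $\delta(\cdot)$ at $\nu_2$. In particular $$|\delta'(\nu_1)-\delta'(\nu_2)|\le c\,|\nu_1-\nu_2|$$ whenever $\delta(\cdot)$ is differentiable at $\nu_1$ and $\nu_2$. -/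

import Mathlib

open MeasureTheory Set
open scoped ENNReal

namespace MinDistance

/-- Lebesgue measure on the reference time interval `I = (0,1)`. -/
noncomputable abbrev timeMeasure : Measure ℝ := volume.restrict (Ioo (0 : ℝ) 1)

section Gelfand

variable {V H : Type*}
  [NormedAddCommGroup V] [InnerProductSpace ℝ V]
  [NormedAddCommGroup H] [InnerProductSpace ℝ H]

/-- For an embedding `ι : V → H`, the induced map `H ≅ H* → V*`, `h ↦ (v ↦ (h, ι v)_H)`. -/
noncomputable def toDualV (ι : V →L[ℝ] H) : H →L[ℝ] StrongDual ℝ V :=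
  ((innerSL ℝ).flip.comp ι).flip

theorem toDualV_apply (ι : V →L[ℝ] H) (h : H) (v : V) :
    toDualV ι h v = inner ℝ h (ι v) := rfl

/-- `g ∈ L²(I; V*)` is the distributional time derivative of `y ∈ L²(I; V)`, where
`V ⊂ H ≅ H* ⊂ V*`. -/
def HasWeakTimeDeriv (ι : V →L[ℝ] H) (y : Lp V 2 timeMeasure)
    (g : Lp (StrongDual ℝ V) 2 timeMeasure) : Prop :=
  ∀ φ : ℝ → ℝ, ContDiff ℝ (⊤ : ℕ∞) φ → HasCompactSupport φ → tsupport φ ⊆ Ioo (0 : ℝ) 1 →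
    ∫ t, deriv φ t • toDualV ι (ι (y t)) ∂timeMeasure = - ∫ t, φ t • g t ∂timeMeasure

/-- The space `W(0,1) = H¹(I; V*) ∩ L²(I; V)`. An element is recorded together with its
(uniquely determined) weak time derivative in `L²(I; V*)` and its (uniquely determined)
representative in `C([0,1]; H)`, so that the trace `i_t y` is `y.rep t`. -/
structure W (ι : V →L[ℝ] H) where
  val : Lp V 2 timeMeasure
  dt : Lp (StrongDual ℝ V) 2 timeMeasure
  rep : C(Icc (0 : ℝ) 1, H)
  hasWeakTimeDeriv : HasWeakTimeDeriv ι val dt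
  rep_ae : ∀ᵐ t ∂timeMeasure, ∀ ht : t ∈ Icc (0 : ℝ) 1, rep ⟨t, ht⟩ = ι (val t)

instance (ι : V →L[ℝ] H) : Nonempty (W ι) := by
  refine ⟨⟨0, 0, 0, ?_, ?_⟩⟩
  · intro φ _ _ _
    have h1 : ∫ t, deriv φ t • toDualV ι (ι ((0 : Lp V 2 timeMeasure) t)) ∂timeMeasure = 0 := by
      apply integral_eq_zero_of_ae
      filter_upwards [Lp.coeFn_zero V 2 timeMeasure] with t ht
      rw [ht]; simp
    have h2 : ∫ t, φ t • (0 : Lp (StrongDual ℝ V) 2 timeMeasure) t ∂timeMeasure = 0 := by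
      apply integral_eq_zero_of_ae
      filter_upwards [Lp.coeFn_zero (StrongDual ℝ V) 2 timeMeasure] with t ht
      rw [ht]; simp
    rw [h1, h2, neg_zero]
  · filter_upwards [Lp.coeFn_zero V 2 timeMeasure] with t ht _
    rw [ht]; simp

end Gelfand

/-- The data of the problem and the standing assumptions on them:
* `ι : V → H` is the (dense, compact) embedding of the Gelfand triple `V ⊂ H ≅ H* ⊂ V*`;
* `a` is a continuous bilinear form on `V` (so `A = a : V → V*`) satisfying Gårding's inequality;
* `B : L²(ω) → V*` is the control operator, `Ω` (with the measure `ρ`) being the measure space `ω`;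
* `ua < ub` are the control bounds in `L^∞(ω)`;
* `y0` and `yd` are the initial and the desired state, `δ₀ > 0` the radius of the target ball. -/
structure Problem (V H : Type*) {Ω : Type*} [MeasurableSpace Ω] (ρ : Measure Ω)
    [NormedAddCommGroup V] [InnerProductSpace ℝ V] [CompleteSpace V]
    [NormedAddCommGroup H] [InnerProductSpace ℝ H] [CompleteSpace H] where
  ι : V →L[ℝ] H
  ι_injective : Function.Injective ι
  ι_denseRange : DenseRange ι
  ι_compact : IsCompactOperator ι
  a : V →L[ℝ] StrongDual ℝ V
  garding : ∃ α₀ : ℝ, 0 < α₀ ∧ ∃ ω₀ : ℝ, 0 ≤ ω₀ ∧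
    ∀ v : V, α₀ * ‖v‖ ^ 2 ≤ a v v + ω₀ * ‖ι v‖ ^ 2
  B : Lp ℝ 2 ρ →L[ℝ] StrongDual ℝ V
  ua : Lp ℝ ⊤ ρ
  ub : Lp ℝ ⊤ ρ
  ua_lt_ub : ∀ᵐ x ∂ρ, ua x < ub x
  y0 : H
  yd : H
  δ₀ : ℝ
  δ₀_pos : 0 < δ₀

/-- The control space `U(0,1) = L²(I; L²(ω))`. -/
abbrev U {Ω : Type*} [MeasurableSpace Ω] (ρ : Measure Ω) : Type _ :=
  Lp (Lp ℝ 2 ρ) 2 timeMeasure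

/-- The `L¹(I × ω)` norm of a control, with value `∞` if the control is not integrable. -/
noncomputable def l1Norm {Ω : Type*} [MeasurableSpace Ω] {ρ : Measure Ω} (w : U ρ) : ℝ≥0∞ :=
  ∫⁻ t, eLpNorm (w t) 1 ρ ∂timeMeasure

/-- `d` is the right or the left derivative of `g` at `x`. -/
def IsOneSidedDeriv (g : ℝ → ℝ) (d x : ℝ) : Prop :=
  HasDerivWithinAt g d (Ici x) x ∨ HasDerivWithinAt g d (Iic x) x

namespace Problem

variable {V H Ω : Type*} [MeasurableSpace Ω] {ρ : Measure Ω}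
  [NormedAddCommGroup V] [InnerProductSpace ℝ V] [CompleteSpace V]
  [NormedAddCommGroup H] [InnerProductSpace ℝ H] [CompleteSpace H]
  (P : Problem V H ρ)

/-- The admissible controls `U_ad ⊂ L²(ω)`. -/
def Uad : Set (Lp ℝ 2 ρ) :=
  {u | ∀ᵐ x ∂ρ, P.ua x ≤ u x ∧ u x ≤ P.ub x}

/-- The admissible controls `U_ad(0,1) ⊂ U(0,1)`. -/
def UadTime : Set (U ρ) :=
  {u | ∀ᵐ t ∂timeMeasure, u t ∈ P.Uad}

/-- `y ∈ W(0,1)` solves `∂ₜ y + ν A y = ν B u`, `y(0) = y₀`. -/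
def IsState (ν : ℝ) (u : U ρ) (y : W P.ι) : Prop :=
  (∀ᵐ t ∂timeMeasure, y.dt t + ν • P.a (y.val t) = ν • P.B (u t)) ∧ y.rep 0 = P.y0

/-- The control-to-state mapping `S(ν, u)`: the unique solution of the transformed state equation
(for `ν > 0`). -/
noncomputable def S (ν : ℝ) (u : U ρ) : W P.ι :=
  Classical.epsilon (P.IsState ν u)

/-- `f(ν, u) = ‖i₁ S(ν, u) - y_d‖ - δ₀`. -/
noncomputable def f (ν : ℝ) (u : U ρ) : ℝ :=
  ‖(P.S ν u).rep 1 - P.yd‖ - P.δ₀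

/-- The set `ū(ν)` of optimal controls of the minimal distance problem. -/
def optimalControls (ν : ℝ) : Set (U ρ) :=
  {u | u ∈ P.UadTime ∧ ∀ u' ∈ P.UadTime, P.f ν u ≤ P.f ν u'}

/-- The minimal distance value function `δ(ν) = inf {f(ν, u) : u ∈ U_ad(0,1)}`. -/
noncomputable def valueFun (ν : ℝ) : ℝ :=
  sInf (P.f ν '' P.UadTime)

/-- `p ∈ W(0,1)` solves `-∂ₜ p + ν A* p = 0`, `p(1) = p₁`, where `⟨A* p, v⟩ = a(v, p)`. -/
def IsAdjointState (ν : ℝ) (p₁ : H) (p : W P.ι) : Prop :=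
  (∀ᵐ t ∂timeMeasure, -p.dt t + ν • P.a.flip (p.val t) = 0) ∧ p.rep 1 = p₁

/-- The adjoint state `p(ν, u)`: the unique solution of the adjoint equation with terminal value
`(y(1) - y_d) / ‖y(1) - y_d‖`, `y = S(ν, u)` (for `ν > 0` and `y(1) ≠ y_d`). -/
noncomputable def adjointState (ν : ℝ) (u : U ρ) : W P.ι :=
  Classical.epsilon (P.IsAdjointState ν
    (‖(P.S ν u).rep 1 - P.yd‖⁻¹ • ((P.S ν u).rep 1 - P.yd)))

/-- The adjoint `B* : V → L²(ω)` of the control operator, `(B* v, u)_{L²(ω)} = ⟨B u, v⟩`. -/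
noncomputable def Bstar (v : V) : Lp ℝ 2 ρ :=
  (InnerProductSpace.toDual ℝ (Lp ℝ 2 ρ)).symm (P.B.flip v)

theorem inner_Bstar (v : V) (u : Lp ℝ 2 ρ) : inner ℝ (P.Bstar v) u = P.B u v := by
  simp [Bstar]

/-- `‖B*(p(ν₁, u) - p(ν₂, u))‖_{L^∞(I × ω)} ≤ c |ν₁ - ν₂|` for all `ν₁, ν₂ ∈ [νmin, νmax]` and all
`u ∈ U_ad(0,1)` for which the two adjoint states are defined. -/
def AdjointStability (νmin νmax c : ℝ) : Prop :=
  ∀ ν₁ ∈ Icc νmin νmax, ∀ ν₂ ∈ Icc νmin νmax, ∀ u ∈ P.UadTime,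
    (P.S ν₁ u).rep 1 ≠ P.yd → (P.S ν₂ u).rep 1 ≠ P.yd →
    ∀ᵐ t ∂timeMeasure, ∀ᵐ x ∂ρ,
      |P.Bstar ((P.adjointState ν₁ u).val t - (P.adjointState ν₂ u).val t) x| ≤ c * |ν₁ - ν₂|

/-- `∂_u f(ν, u)(u' - u) ≥ ν c₀ ‖u' - u‖²_{L¹(I × ω)}` for all `u' ∈ U_ad(0,1)`. -/
def GrowthCondition (ν : ℝ) (u : U ρ) (c₀ : ℝ) : Prop :=
  ∀ u' ∈ P.UadTime,
    ENNReal.ofReal (ν * c₀) * l1Norm (u' - u) ^ 2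
      ≤ ENNReal.ofReal (fderiv ℝ (P.f ν) u (u' - u))

/-- `B ∈ L(L¹(ω), H)`: there is a bounded linear operator `L¹(ω) → H` which coincides with `B` on
`L¹(ω) ∩ L²(ω)`. -/
def ControlOperatorL1H : Prop :=
  ∃ B₁ : Lp ℝ 1 ρ →L[ℝ] H, ∀ (u₁ : Lp ℝ 1 ρ) (u₂ : Lp ℝ 2 ρ),
    u₁ =ᵐ[ρ] u₂ → toDualV P.ι (B₁ u₁) = P.B u₂

end Problem

end MinDistance

/-! The argument separates an abstract fact about infima of parametrised functions from parabolic
estimates that make it applicable.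

Abstract part (`GrowthFamily`). Let each `f(·, u)` have a derivative `F(·, u)` that is `L`-Lipschitz
uniformly in `u`. Subtracting `L x² / 2` makes every `f(·, u)` concave, hence also the infimum, so
the value function has one-sided derivatives. Suppose also that `F(x, u)` differs from `F(x, u₀)` by
at most `L N(u)` and that `f(x₀, ·)` exceeds its minimum by at least `κ N(u)²`. A near-minimiser at
`x` is then near-optimal at `x₀` up to `L N(u) |x - x₀|`, and quadratic growth turns this into `N(u)
≲ |x - x₀|` (`N_le`). Using it as a competitor at `y` shows that the value function differs from the
line of slope `F(x₀, u₀)` by `O(max(|x - x₀|, |y - x₀|) |y - x|)` between `x` and `y`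
(`abs_sub_le`). Hence a one-sided derivative at `x` lies within `C |x - x₀|` of `F(x₀, u₀)`. For
parameters on opposite sides of `x₀` the two errors add up to `C |ν₁ - ν₂|`, which is why the
estimate holds across `ν_bar` only.

Application (`exists_growthFamily`). Here `N(u)` is the `L¹` distance to the optimal control. The
convexity of `f(ν_bar, ·)` converts the growth of the linearisation into growth of `f` itself. The
delicate point is to control states and their `ν`-derivatives by the `L¹` norm of the control only:
`B ∈ L(L¹(ω), H)` bounds the pairing of `B w` with `y` by the `L¹` norm of `w` times the `C([0,1];
H)` norm of `y`, and the energy estimate accepts right-hand sides bounded in this weak sense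
(`Dominated`, `evolutionSpace_apriori`).

Well-posedness of the state equation is proved along the way: the energy identity passes to the
closure of smooth triples (`evolutionSpace`), the estimate gives closed range, a duality argument
gives dense range (`annihilator_eq_zero`), and a uniqueness argument identifies the closure with
`W(0,1)`. -/

namespace MinDistance
open Filter Topology

/-! ### Absolutely continuous functions, Grönwall inequalities and du Bois-Reymond on the unit
interval. -/

section Calculus

/-- Serves twice: to compare a vector-valued primitive with the primitive of the norm, and a
bilinear product with its two factors. -/
theorem absolutelyContinuousOnInterval_of_dist_le {X Y Z : Type*} [PseudoMetricSpace X]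
    [PseudoMetricSpace Y] [PseudoMetricSpace Z] {f : ℝ → X} {g : ℝ → Y} {h : ℝ → Z} {a b C : ℝ}
    (hg : AbsolutelyContinuousOnInterval g a b) (hh : AbsolutelyContinuousOnInterval h a b)
    (hf : ∀ x ∈ uIcc a b, ∀ y ∈ uIcc a b,
      dist (f x) (f y) ≤ C * (dist (g x) (g y) + dist (h x) (h y))) :
    AbsolutelyContinuousOnInterval f a b := by
  unfold AbsolutelyContinuousOnInterval at hg hh
  apply squeeze_zero' ?_ ?_ (by simpa using (hg.add hh).const_mul C)
  · exact Eventually.of_forall fun _ ↦ Finset.sum_nonneg fun i hi ↦ dist_nonneg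
  rw [eventually_inf_principal]
  filter_upwards with ⟨n, I⟩ hnI
  simp only [AbsolutelyContinuousOnInterval.disjWithin, mem_ofPred_eq] at hnI
  rw [← Finset.sum_add_distrib, Finset.mul_sum]
  exact Finset.sum_le_sum fun i hi ↦ hf _ (hnI.1 i hi).1 _ (hnI.1 i hi).2

variable {E F G : Type*} [NormedAddCommGroup E] [NormedSpace ℝ E]
  [NormedAddCommGroup F] [NormedSpace ℝ F] [NormedAddCommGroup G] [NormedSpace ℝ G]

omit [NormedSpace ℝ E] in
theorem _root_.IntervalIntegrable.mono_zero_one {a : ℝ → E} (ha : IntervalIntegrable a volume 0 1)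
    {s t : ℝ} (hs : s ∈ Icc (0 : ℝ) 1) (ht : t ∈ Icc (0 : ℝ) 1) :
    IntervalIntegrable a volume s t :=
  ha.mono_set (by rw [uIcc_of_le zero_le_one]; exact uIcc_subset_Icc hs ht)

theorem continuousOn_primitive_Icc {a : ℝ → E} (ha : IntervalIntegrable a volume 0 1) :
    ContinuousOn (fun t => ∫ s in (0 : ℝ)..t, a s) (Icc 0 1) := by
  have := intervalIntegral.continuousOn_primitive_interval' ha (a := 0) (by simp)
  rwa [uIcc_of_le zero_le_one] at this

theorem absolutelyContinuousOnInterval_primitive {a : ℝ → E}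
    (ha : IntervalIntegrable a volume 0 1) (e : E) :
    AbsolutelyContinuousOnInterval (fun t => e + ∫ s in (0 : ℝ)..t, a s) 0 1 := by
  have h := ha.norm.absolutelyContinuousOnInterval_intervalIntegral (c := 0) (by simp)
  refine absolutelyContinuousOnInterval_of_dist_le (C := 1) h h fun x hx y hy => ?_
  rw [uIcc_of_le zero_le_one] at hx hy
  have h0 : (0 : ℝ) ∈ Icc (0 : ℝ) 1 := by simp
  rw [dist_add_left, dist_eq_norm, intervalIntegral.integral_interval_sub_left
    (ha.mono_zero_one h0 hx) (ha.mono_zero_one h0 hy), dist_eq_norm,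
    intervalIntegral.integral_interval_sub_left
    (ha.norm.mono_zero_one h0 hx) (ha.norm.mono_zero_one h0 hy)]
  have := intervalIntegral.norm_integral_le_abs_integral_norm (f := a) (a := y) (b := x)
    (μ := volume)
  rw [Real.norm_eq_abs]
  linarith [abs_nonneg (∫ s in y..x, ‖a s‖)]

/-- Integration by parts for a continuous bilinear map applied to two primitives. -/
theorem bilin_primitive [CompleteSpace E] [CompleteSpace F] [CompleteSpace G]
    (L : E →L[ℝ] F →L[ℝ] G) {a : ℝ → E} {b : ℝ → F}
    (ha : IntervalIntegrable a volume 0 1) (hb : IntervalIntegrable b volume 0 1) (e : E) (f : F)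
    {t : ℝ} (ht : t ∈ Icc (0 : ℝ) 1) :
    L (e + ∫ s in (0 : ℝ)..t, a s) (f + ∫ s in (0 : ℝ)..t, b s) = L e f +
      ∫ s in (0 : ℝ)..t, (L (a s) (f + ∫ r in (0 : ℝ)..s, b r)
        + L (e + ∫ r in (0 : ℝ)..s, a r) (b s)) := by
  set u : ℝ → E := fun t => e + ∫ s in (0 : ℝ)..t, a s with hu
  set v : ℝ → F := fun t => f + ∫ s in (0 : ℝ)..t, b s with hv
  set k : ℝ → G := fun s => L (a s) (v s) + L (u s) (b s) with hk
  have huac := absolutelyContinuousOnInterval_primitive ha e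
  have hvac := absolutelyContinuousOnInterval_primitive hb f
  have hki : IntervalIntegrable k volume 0 1 := by
    rw [intervalIntegrable_iff_integrableOn_Icc_of_le zero_le_one] at ha hb ⊢
    have hum : AEStronglyMeasurable u (volume.restrict (Icc 0 1)) := by
      have := huac.continuousOn
      rw [uIcc_of_le zero_le_one] at this
      exact this.aestronglyMeasurable measurableSet_Icc
    have hvm : AEStronglyMeasurable v (volume.restrict (Icc 0 1)) := by
      have := hvac.continuousOn
      rw [uIcc_of_le zero_le_one] at this
      exact this.aestronglyMeasurable measurableSet_Icc
    obtain ⟨Cu, hCu⟩ := huac.exists_bound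
    obtain ⟨Cv, hCv⟩ := hvac.exists_bound
    rw [uIcc_of_le zero_le_one] at hCu hCv
    exact (L.integrable_of_bilin_of_bdd_right Cv ha hvm
      ((ae_restrict_iff' measurableSet_Icc).2 (ae_of_all _ hCv))).add
      (L.integrable_of_bilin_of_bdd_left Cu hum
      ((ae_restrict_iff' measurableSet_Icc).2 (ae_of_all _ hCu)) hb)
  have hLac : AbsolutelyContinuousOnInterval (fun t => L (u t) (v t)) 0 1 := by
    obtain ⟨Cu, hCu⟩ := huac.exists_bound
    obtain ⟨Cv, hCv⟩ := hvac.exists_bound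
    refine absolutelyContinuousOnInterval_of_dist_le (C := ‖L‖ * (Cu + Cv)) huac hvac
      fun x hx y hy => ?_
    change dist (L (u x) (v x)) (L (u y) (v y)) ≤ _ * (dist (u x) (u y) + dist (v x) (v y))
    have h1 : L (u x) (v x) - L (u y) (v y) = L (u x - u y) (v x) + L (u y) (v x - v y) := by
      simp
    rw [dist_eq_norm, dist_eq_norm, dist_eq_norm, h1]
    have h2 := L.le_opNorm₂ (u x - u y) (v x)
    have h3 := L.le_opNorm₂ (u y) (v x - v y)
    have h4 := hCv x hx
    have h5 := hCu y hy
    have h6 : 0 ≤ Cu := (norm_nonneg _).trans h5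
    have h7 : 0 ≤ Cv := (norm_nonneg _).trans h4
    calc _ ≤ ‖L‖ * ‖u x - u y‖ * ‖v x‖ + ‖L‖ * ‖u y‖ * ‖v x - v y‖ :=
          (norm_add_le _ _).trans (add_le_add h2 h3)
      _ ≤ ‖L‖ * ‖u x - u y‖ * Cv + ‖L‖ * Cu * ‖v x - v y‖ := by
          gcongr
      _ ≤ _ := by
          have := mul_nonneg (mul_nonneg (norm_nonneg L) h6) (norm_nonneg (u x - u y))
          have := mul_nonneg (mul_nonneg (norm_nonneg L) h7) (norm_nonneg (v x - v y))
          linarith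
  have hac := hLac.sub (absolutelyContinuousOnInterval_primitive hki (L e f))
  -- The difference of the two sides is absolutely continuous with derivative zero almost
  -- everywhere, hence constant; it vanishes at `0`.
  obtain ⟨C, hC⟩ := hac.const_of_ae_hasDerivAt_zero (by
    filter_upwards [ha.ae_hasDerivAt_integral, hb.ae_hasDerivAt_integral,
      hki.ae_hasDerivAt_integral] with x h1 h2 h3 hx
    have d1 : HasDerivAt u (a x) x := (h1 hx 0 (by simp)).const_add e
    have d2 : HasDerivAt v (b x) x := (h2 hx 0 (by simp)).const_add f
    have d3 : HasDerivAt (fun t => L e f + ∫ s in (0 : ℝ)..t, k s) (k x) x :=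
      (h3 hx 0 (by simp)).const_add _
    have d4 : HasDerivAt (fun t => L (u t) (v t)) (k x) x := by
      have := (L.hasFDerivAt.comp_hasDerivAt x d1).clm_apply d2
      simpa [hk] using this
    simpa using d4.sub d3)
  have h0 := hC 0 (by simp)
  have h1 := hC t (by rwa [uIcc_of_le zero_le_one])
  simp only [Pi.sub_apply, hu, hv, intervalIntegral.integral_same, add_zero, sub_self] at h0 h1
  rw [← h0, sub_eq_zero] at h1
  exact h1

/-- Grönwall's inequality in integral form on the unit interval. -/
theorem gronwall_unit {φ : ℝ → ℝ} {K c : ℝ} (hc : 0 ≤ c) (hK : 0 ≤ K)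
    (hφ : ContinuousOn φ (Icc 0 1))
    (h : ∀ t ∈ Icc (0 : ℝ) 1, φ t ≤ K + c * ∫ s in (0 : ℝ)..t, φ s) :
    ∀ t ∈ Icc (0 : ℝ) 1, φ t ≤ K * Real.exp c := by
  -- The constant extension beyond the end points makes the primitive differentiable at every point,
  -- end points included.
  set ψ : ℝ → ℝ := IccExtend zero_le_one ((Icc (0 : ℝ) 1).domRestrict φ) with hψ
  have hψc : Continuous ψ := hφ.domRestrict.Icc_extend'
  have hψφ : ∀ t ∈ Icc (0 : ℝ) 1, ψ t = φ t := fun t ht => IccExtend_of_mem _ _ ht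
  have hI : ∀ t ∈ Icc (0 : ℝ) 1, ∫ s in (0 : ℝ)..t, φ s = ∫ s in (0 : ℝ)..t, ψ s := by
    intro t ht
    refine intervalIntegral.integral_congr fun s hs => (hψφ s ?_).symm
    rw [uIcc_of_le ht.1] at hs
    exact ⟨hs.1, hs.2.trans ht.2⟩
  have hd : ∀ t, HasDerivAt (fun t => ∫ s in (0 : ℝ)..t, ψ s) (ψ t) t := fun t =>
    (hψc.integral_hasStrictDerivAt 0 t).hasDerivAt
  have hE := le_gronwallBound_of_liminf_deriv_right_le (f := fun t => ∫ s in (0 : ℝ)..t, ψ s)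
    (f' := ψ) (δ := 0) (K := c) (ε := K) (a := 0) (b := 1)
    (fun t _ => (hd t).continuousAt.continuousWithinAt)
    (fun t _ r hr => by
      simpa [slope] using (hd t).hasDerivWithinAt.liminf_right_slope_le hr)
    (by simp) (fun t ht => by
      have ht' : t ∈ Icc (0 : ℝ) 1 := Ico_subset_Icc_self ht
      rw [hψφ t ht', ← hI t ht', add_comm]
      exact h t ht')
  intro t ht
  have h1 := h t ht
  have h2 := hE t ht
  rw [← hI t ht, sub_zero] at h2
  have h3 : K + c * gronwallBound 0 c K t = K * Real.exp (c * t) := by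
    by_cases hc0 : c = 0
    · simp [hc0]
    · rw [gronwallBound_of_K_ne_0 hc0]
      field_simp
      ring
  calc φ t ≤ K + c * gronwallBound 0 c K t := by
        linarith [mul_le_mul_of_nonneg_left h2 hc]
    _ = K * Real.exp (c * t) := h3
    _ ≤ K * Real.exp c := by
        gcongr
        nlinarith [ht.2]

theorem gronwall_unit_backward {φ : ℝ → ℝ} {c : ℝ} (hc : 0 ≤ c)
    (hφ : ContinuousOn φ (Icc 0 1))
    (h : ∀ t ∈ Icc (0 : ℝ) 1, φ t ≤ c * ∫ s in t..1, φ s) :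
    ∀ t ∈ Icc (0 : ℝ) 1, φ t ≤ 0 := by
  intro t ht
  have hm : ∀ {s : ℝ}, s ∈ Icc (0 : ℝ) 1 → 1 - s ∈ Icc (0 : ℝ) 1 := fun hs =>
    ⟨by linarith [hs.2], by linarith [hs.1]⟩
  have := gronwall_unit (φ := fun s => φ (1 - s)) hc le_rfl
    (hφ.comp (by fun_prop) fun s hs => hm hs) (fun s hs => by
      rw [intervalIntegral.integral_comp_sub_left (fun x => φ x)]
      simpa using h (1 - s) (hm hs)) (1 - t) (hm ht)
  simpa using this

/-- du Bois-Reymond's lemma for continuous functions on the unit interval. -/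
theorem eq_of_forall_integral_deriv_smul_eq_zero [CompleteSpace E] {F : ℝ → E}
    (hF : ContinuousOn F (Icc 0 1))
    (h : ∀ φ : ℝ → ℝ, ContDiff ℝ (⊤ : ℕ∞) φ → HasCompactSupport φ → tsupport φ ⊆ Ioo (0 : ℝ) 1 →
      ∫ t, deriv φ t • F t ∂timeMeasure = 0) :
    ∀ t ∈ Icc (0 : ℝ) 1, F t = F 0 := by
  have hFi : Integrable F timeMeasure :=
    (hF.integrableOn_Icc).mono_set Ioo_subset_Icc_self
  let B : ContDiffBump (1 / 2 : ℝ) := ⟨1 / 8, 1 / 4, by norm_num, by norm_num⟩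
  set ψ : ℝ → ℝ := B.normed volume with hψ
  have hψd : ContDiff ℝ (⊤ : ℕ∞) ψ := B.contDiff_normed
  have hψs : HasCompactSupport ψ := B.hasCompactSupport_normed
  have hψt : tsupport ψ ⊆ Ioo 0 1 := by
    rw [hψ, B.tsupport_normed_eq, Real.closedBall_eq_Icc]
    intro x hx
    simp only [B, mem_Icc] at hx
    constructor <;> linarith [hx.1, hx.2]
  have hψ1 : ∫ t, ψ t = 1 := B.integral_normed
  have hint : ∀ {η : ℝ → ℝ}, ContDiff ℝ (⊤ : ℕ∞) η → HasCompactSupport η →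
      Integrable η volume := fun h1 h2 => h1.continuous.integrable_of_hasCompactSupport h2
  have hsmul : ∀ {η : ℝ → ℝ}, ContDiff ℝ (⊤ : ℕ∞) η → HasCompactSupport η →
      Integrable (fun t => η t • F t) timeMeasure := by
    intro η h1 h2
    obtain ⟨C, hC⟩ := h2.exists_bound_of_continuous h1.continuous
    exact (hFi.bdd_smul C h1.continuous.aestronglyMeasurable (ae_of_all _ hC))
  set c : E := ∫ t, ψ t • F t ∂timeMeasure with hc
  have key : ∀ η : ℝ → ℝ, ContDiff ℝ (⊤ : ℕ∞) η → HasCompactSupport η →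
      tsupport η ⊆ Ioo (0 : ℝ) 1 → ∫ t, η t • (F t - c) ∂timeMeasure = 0 := by
    intro η hηd hηs hηt
    set m : ℝ := ∫ t, η t with hm
    -- Removing the mean by a fixed bump makes the primitive of `θ` compactly supported in the open
    -- interval, so it is an admissible test function with derivative `θ`.
    set θ : ℝ → ℝ := fun t => η t - m * ψ t with hθ
    have hθd : ContDiff ℝ (⊤ : ℕ∞) θ := hηd.sub (contDiff_const.mul hψd)
    have hθsupp : tsupport θ ⊆ tsupport η ∪ tsupport ψ := by
      refine closure_minimal (fun t ht => ?_) (isClosed_closure.union isClosed_closure)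
      by_contra hcon
      simp only [mem_union, not_or] at hcon
      apply ht
      simp [hθ, image_eq_zero_of_notMem_tsupport hcon.1, image_eq_zero_of_notMem_tsupport hcon.2]
    have hθ0 : ∫ t, θ t = 0 := by
      rw [hθ, integral_sub (hint hηd hηs) ((hint hψd hψs).const_mul m), integral_const_mul, hψ1]
      simp [hm]
    -- The point `1 / 2` is added only to have nonemptiness at hand for the extremal points `p` and
    -- `q`.
    have hK : IsCompact (tsupport η ∪ tsupport ψ ∪ {1 / 2}) :=
      (hηs.union hψs).union isCompact_singleton
    have hKn : (tsupport η ∪ tsupport ψ ∪ {1 / 2}).Nonempty := ⟨1 / 2, by simp⟩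
    have hKs : tsupport η ∪ tsupport ψ ∪ {1 / 2} ⊆ Ioo (0 : ℝ) 1 :=
      union_subset (union_subset hηt hψt) (by norm_num)
    obtain ⟨p, hpK, hp⟩ := hK.exists_isLeast hKn
    obtain ⟨q, hqK, hq⟩ := hK.exists_isGreatest hKn
    have hp0 := hKs hpK
    have hq0 := hKs hqK
    have hθz : ∀ t, t ∉ Icc p q → θ t = 0 := by
      intro t ht
      by_contra hcon
      have : t ∈ tsupport η ∪ tsupport ψ ∪ {1 / 2} :=
        Or.inl (hθsupp (subset_tsupport _ hcon))
      exact ht ⟨hp this, hq this⟩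
    set φ : ℝ → ℝ := fun t => ∫ s in (0 : ℝ)..t, θ s with hφ
    have hφd : ∀ t, HasDerivAt φ (θ t) t := fun t =>
      (hθd.continuous.integral_hasStrictDerivAt 0 t).hasDerivAt
    have hφ' : deriv φ = θ := funext fun t => (hφd t).deriv
    have hφz : ∀ t, t ∉ Icc p q → φ t = 0 := by
      intro t ht
      rcases lt_or_ge t p with h1 | h1
      · refine (intervalIntegral.integral_congr (g := fun _ => (0 : ℝ)) fun s hs => ?_).trans
          (by simp)
        refine hθz s fun hs' => ?_
        have := hs.2
        rcases le_max_iff.1 this with h2 | h2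
        · linarith [hp0.1, hs'.1]
        · linarith [hs'.1]
      · have h2 : q < t := by
          by_contra hcon
          exact ht ⟨h1, not_lt.1 hcon⟩
        rw [hφ, ← hθ0]
        refine intervalIntegral.integral_eq_integral_of_support_subset fun s hs => ?_
        have hs' : s ∈ Icc p q := by
          by_contra hcon
          exact hs (hθz s hcon)
        exact ⟨by linarith [hp0.1, hs'.1], by linarith [hs'.2]⟩
    have hφt : tsupport φ ⊆ Icc p q := closure_minimal (fun t ht => by
      by_contra hcon
      exact ht (hφz t hcon)) isClosed_Icc
    have h0 := h φ (contDiff_infty_iff_deriv.2 ⟨fun t => (hφd t).differentiableAt, by rwa [hφ']⟩)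
      (HasCompactSupport.of_support_subset_isCompact isCompact_Icc
        ((subset_tsupport _).trans hφt))
      (hφt.trans fun t ht => ⟨hp0.1.trans_le ht.1, ht.2.trans_lt hq0.2⟩)
    rw [hφ'] at h0
    have h1 : ∫ t, η t ∂timeMeasure = m := by
      refine setIntegral_eq_integral_of_forall_compl_eq_zero fun t ht => ?_
      exact image_eq_zero_of_notMem_tsupport fun h => ht (hηt h)
    have h2 : ∫ t, θ t • F t ∂timeMeasure = ∫ t, η t • F t ∂timeMeasure - m • c := by
      have hi : Integrable (fun t => m • ψ t • F t) timeMeasure := (hsmul hψd hψs).smul m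
      rw [hc, ← integral_smul, ← integral_sub (hsmul hηd hηs) hi]
      refine integral_congr_ae (ae_of_all _ fun t => ?_)
      simp [hθ, sub_smul, mul_smul]
    simp only [smul_sub]
    rw [integral_sub (hsmul hηd hηs) ((hint hηd hηs).restrict.smul_const c),
      integral_smul_const, h1, ← h2, h0]
  have hae := isOpen_Ioo.ae_eq_zero_of_integral_contDiff_smul_eq_zero (μ := timeMeasure)
    (f := fun t => F t - c) (U := Ioo (0 : ℝ) 1)
    ((hFi.sub (integrable_const c)).locallyIntegrable.locallyIntegrableOn _) key
  have hconst : ∀ t ∈ Icc (0 : ℝ) 1, F t = c := by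
    refine Measure.eqOn_Icc_of_ae_eq volume zero_ne_one ?_ hF continuousOn_const
    rw [← restrict_Ioo_eq_restrict_Icc]
    filter_upwards [hae, ae_restrict_mem measurableSet_Ioo] with t ht ht'
    exact sub_eq_zero.1 (ht ht')
  intro t ht
  rw [hconst t ht, hconst 0 (by simp)]

end Calculus

end MinDistance

namespace MinDistance
open Filter Topology

/-! ### Primitives and integrated bilinear pairings as continuous maps on `L²(I; ·)`. -/

section TimeLp

variable {E F G : Type*} [NormedAddCommGroup E] [NormedSpace ℝ E]
  [NormedAddCommGroup F] [NormedSpace ℝ F] [NormedAddCommGroup G] [NormedSpace ℝ G]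

instance : IsProbabilityMeasure timeMeasure := ⟨by simp [timeMeasure]⟩

theorem integral_timeMeasure (f : ℝ → E) :
    ∫ t, f t ∂timeMeasure = ∫ t in (0 : ℝ)..1, f t := by
  rw [intervalIntegral.integral_of_le zero_le_one, integral_Ioc_eq_integral_Ioo]

omit [NormedSpace ℝ E] in
theorem intervalIntegrable_zero_one_iff {f : ℝ → E} :
    IntervalIntegrable f volume 0 1 ↔ Integrable f timeMeasure := by
  rw [intervalIntegrable_iff_integrableOn_Ioo_of_le zero_le_one]
  rfl

omit [NormedSpace ℝ E] in
theorem lp_intervalIntegrable (y : Lp E 2 timeMeasure) : IntervalIntegrable y volume 0 1 :=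
  intervalIntegrable_zero_one_iff.2 ((Lp.memLp y).integrable one_le_two)

theorem ae_time_iff {p : ℝ → Prop} :
    (∀ᵐ t ∂timeMeasure, p t) ↔ ∀ᵐ t, t ∈ Icc (0 : ℝ) 1 → p t := by
  rw [timeMeasure, restrict_Ioo_eq_restrict_Icc, ae_restrict_iff' measurableSet_Icc]

theorem ae_uIoc_of_ae_time {p : ℝ → Prop} (h : ∀ᵐ t ∂timeMeasure, p t) {s t : ℝ}
    (hs : s ∈ Icc (0 : ℝ) 1) (ht : t ∈ Icc (0 : ℝ) 1) :
    ∀ᵐ x, x ∈ uIoc s t → p x := by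
  filter_upwards [ae_time_iff.1 h] with x hx hx'
  exact hx (uIcc_subset_Icc hs ht (uIoc_subset_uIcc hx'))

theorem intervalIntegral_congr_time {f g : ℝ → E} (h : ∀ᵐ t ∂timeMeasure, f t = g t) {s t : ℝ}
    (hs : s ∈ Icc (0 : ℝ) 1) (ht : t ∈ Icc (0 : ℝ) 1) :
    ∫ x in s..t, f x = ∫ x in s..t, g x :=
  intervalIntegral.integral_congr_ae (ae_uIoc_of_ae_time h hs ht)

theorem norm_intervalIntegral_le_integral_norm {f : ℝ → E} (hf : Integrable f timeMeasure)
    {t : ℝ} (ht : t ∈ Icc (0 : ℝ) 1) :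
    ‖∫ s in (0 : ℝ)..t, f s‖ ≤ ∫ s, ‖f s‖ ∂timeMeasure := by
  have h0 : (0 : ℝ) ∈ Icc (0 : ℝ) 1 := by simp
  have h1 : (1 : ℝ) ∈ Icc (0 : ℝ) 1 := by simp
  have hf' := (intervalIntegrable_zero_one_iff.2 hf).norm
  rw [integral_timeMeasure, ← intervalIntegral.integral_add_adjacent_intervals
    (hf'.mono_zero_one h0 ht) (hf'.mono_zero_one ht h1)]
  have h2 := intervalIntegral.norm_integral_le_integral_norm (f := f) (μ := volume) ht.1
  have h3 : 0 ≤ ∫ s in t..1, ‖f s‖ :=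
    intervalIntegral.integral_nonneg ht.2 fun _ _ => norm_nonneg _
  linarith

theorem norm_intervalIntegral_lp_le (g : Lp E 2 timeMeasure) {t : ℝ} (ht : t ∈ Icc (0 : ℝ) 1) :
    ‖∫ s in (0 : ℝ)..t, g s‖ ≤ ‖g‖ := by
  have hg := Lp.memLp g
  refine (norm_intervalIntegral_le_integral_norm (hg.integrable one_le_two) ht).trans ?_
  rw [integral_norm_eq_lintegral_enorm hg.1, ← eLpNorm_one_eq_lintegral_enorm, Lp.norm_def]
  exact ENNReal.toReal_mono hg.2.ne (eLpNorm_le_eLpNorm_of_exponent_le one_le_two hg.1)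

theorem integrable_bilin (L : E →L[ℝ] F →L[ℝ] G) (f : Lp E 2 timeMeasure)
    (g : Lp F 2 timeMeasure) : Integrable (fun t => L (f t) (g t)) timeMeasure :=
  memLp_one_iff_integrable.1 (L.memLp_of_bilin 1 (Lp.memLp f) (Lp.memLp g))

theorem norm_intervalIntegral_bilin_le (L : E →L[ℝ] F →L[ℝ] G) (f : Lp E 2 timeMeasure)
    (g : Lp F 2 timeMeasure) {t : ℝ} (ht : t ∈ Icc (0 : ℝ) 1) :
    ‖∫ s in (0 : ℝ)..t, L (f s) (g s)‖ ≤ ‖L‖ * ‖f‖ * ‖g‖ := by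
  refine (norm_intervalIntegral_le_integral_norm (integrable_bilin L f g) ht).trans ?_
  refine le_trans (le_of_eq ?_) (L.norm_holder_apply_apply_le (r := 1) f g)
  rw [L1.norm_eq_integral_norm]
  refine integral_congr_ae ?_
  filter_upwards [L.coeFn_holder (r := 1) f g] with s hs
  rw [hs]

/-- The primitive at time `t` as a continuous linear map on `L²(I; E)`. -/
noncomputable def primitiveCLM (E : Type*) [NormedAddCommGroup E] [NormedSpace ℝ E]
    (t : Icc (0 : ℝ) 1) : Lp E 2 timeMeasure →L[ℝ] E :=
  LinearMap.mkContinuous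
    { toFun := fun g => ∫ s in (0 : ℝ)..t, g s
      map_add' := fun f g => by
        rw [intervalIntegral_congr_time (Lp.coeFn_add f g) (by simp) t.2]
        exact intervalIntegral.integral_add
          ((lp_intervalIntegrable f).mono_zero_one (by simp) t.2)
          ((lp_intervalIntegrable g).mono_zero_one (by simp) t.2)
      map_smul' := fun c g => by
        rw [intervalIntegral_congr_time (Lp.coeFn_smul c g) (by simp) t.2]
        exact intervalIntegral.integral_smul _ _ }
    1 fun g => by simpa using norm_intervalIntegral_lp_le g t.2

theorem primitiveCLM_apply (t : Icc (0 : ℝ) 1) (g : Lp E 2 timeMeasure) :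
    primitiveCLM E t g = ∫ s in (0 : ℝ)..t, g s := rfl

/-- `(f, g) ↦ ∫₀ᵗ L(f, g)` as a continuous bilinear map on `L²(I; E) × L²(I; F)`. -/
noncomputable def integralBilin (L : E →L[ℝ] F →L[ℝ] G) (t : Icc (0 : ℝ) 1) :
    Lp E 2 timeMeasure →L[ℝ] Lp F 2 timeMeasure →L[ℝ] G :=
  LinearMap.mkContinuous₂
    (LinearMap.mk₂ ℝ (fun f g => ∫ s in (0 : ℝ)..t, L (f s) (g s))
      (fun f f' g => by
        rw [← intervalIntegral.integral_add
          ((intervalIntegrable_zero_one_iff.2 (integrable_bilin L f g)).mono_zero_one (by simp) t.2)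
          ((intervalIntegrable_zero_one_iff.2
            (integrable_bilin L f' g)).mono_zero_one (by simp) t.2)]
        refine intervalIntegral_congr_time ?_ (by simp) t.2
        filter_upwards [Lp.coeFn_add f f'] with s hs
        rw [hs]
        simp)
      (fun c f g => by
        rw [← intervalIntegral.integral_smul]
        refine intervalIntegral_congr_time ?_ (by simp) t.2
        filter_upwards [Lp.coeFn_smul c f] with s hs
        rw [hs]
        simp)
      (fun f g g' => by
        rw [← intervalIntegral.integral_add
          ((intervalIntegrable_zero_one_iff.2 (integrable_bilin L f g)).mono_zero_one (by simp) t.2)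
          ((intervalIntegrable_zero_one_iff.2
            (integrable_bilin L f g')).mono_zero_one (by simp) t.2)]
        refine intervalIntegral_congr_time ?_ (by simp) t.2
        filter_upwards [Lp.coeFn_add g g'] with s hs
        rw [hs]
        simp)
      (fun c f g => by
        rw [← intervalIntegral.integral_smul]
        refine intervalIntegral_congr_time ?_ (by simp) t.2
        filter_upwards [Lp.coeFn_smul c g] with s hs
        rw [hs]
        simp))
    ‖L‖ fun f g => norm_intervalIntegral_bilin_le L f g t.2

theorem integralBilin_apply (L : E →L[ℝ] F →L[ℝ] G) (t : Icc (0 : ℝ) 1)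
    (f : Lp E 2 timeMeasure) (g : Lp F 2 timeMeasure) :
    integralBilin L t f g = ∫ s in (0 : ℝ)..t, L (f s) (g s) := rfl

omit [NormedSpace ℝ E] in
theorem memLp_IccExtend (r : C(Icc (0 : ℝ) 1, E)) :
    MemLp (IccExtend zero_le_one r) 2 timeMeasure :=
  MemLp.of_bound (r.continuous.Icc_extend').aestronglyMeasurable ‖r‖
    (ae_of_all _ fun _ => r.norm_coe_le_norm _)

/-- The embedding `C([0,1]; E) → L²(I; E)`. -/
noncomputable def contToLp (E : Type*) [NormedAddCommGroup E] [NormedSpace ℝ E] :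
    C(Icc (0 : ℝ) 1, E) →L[ℝ] Lp E 2 timeMeasure :=
  LinearMap.mkContinuous
    { toFun := fun r => (memLp_IccExtend r).toLp
      map_add' := fun r r' => by
        rw [← MemLp.toLp_add]
        rfl
      map_smul' := fun c r => by
        rw [RingHom.id_apply, ← MemLp.toLp_const_smul]
        rfl }
    1 fun r => by
      have := Lp.norm_le_of_ae_bound (f := (memLp_IccExtend r).toLp) (norm_nonneg r) (by
        filter_upwards [(memLp_IccExtend r).coeFn_toLp] with t ht
        rw [ht]
        exact r.norm_coe_le_norm _)
      simpa [measureUnivNNReal] using this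

theorem contToLp_ae (r : C(Icc (0 : ℝ) 1, E)) :
    contToLp E r =ᵐ[timeMeasure] IccExtend zero_le_one r :=
  (memLp_IccExtend r).coeFn_toLp

theorem norm_sq_lp_eq {V : Type*} [NormedAddCommGroup V] [InnerProductSpace ℝ V]
    (y : Lp V 2 timeMeasure) : ‖y‖ ^ 2 = ∫ t in (0 : ℝ)..1, ‖y t‖ ^ 2 := by
  rw [← real_inner_self_eq_norm_sq, L2.inner_def, integral_timeMeasure]
  simp

end TimeLp

end MinDistance

namespace MinDistance
open Filter Topology

/-! ### A closure model of `W(0,1)` and the energy identity. -/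

section Evolution

variable {V H : Type*}
  [NormedAddCommGroup V] [InnerProductSpace ℝ V] [NormedAddCommGroup H] [InnerProductSpace ℝ H]

/-- Triples consisting of a function in `L²(I; V)`, a candidate for its time derivative in
`L²(I; V*)` and a candidate for its representative in `C([0,1]; H)`. -/
abbrev Triple (V H : Type*) [NormedAddCommGroup V] [InnerProductSpace ℝ V]
    [NormedAddCommGroup H] [InnerProductSpace ℝ H] : Type _ :=
  Lp V 2 timeMeasure × Lp (StrongDual ℝ V) 2 timeMeasure × C(Icc (0 : ℝ) 1, H)

/-- The embedding `V → H ≅ H* → V*`. -/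
noncomputable def embDual (ι : V →L[ℝ] H) : V →L[ℝ] StrongDual ℝ V := (toDualV ι).comp ι

theorem embDual_apply (ι : V →L[ℝ] H) (v w : V) : embDual ι v w = inner ℝ (ι v) (ι w) := rfl

/-- The triple is the primitive, with initial value in `V`, of a function in `L²(I; V)`. -/
def IsRegular (ι : V →L[ℝ] H) (v : V) (w : Lp V 2 timeMeasure) (z : Triple V H) : Prop :=
  (∀ᵐ t ∂timeMeasure, z.1 t = v + ∫ s in (0 : ℝ)..t, w s) ∧
  (∀ᵐ t ∂timeMeasure, z.2.1 t = embDual ι (w t)) ∧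
  ∀ t : Icc (0 : ℝ) 1, z.2.2 t = ι (v + ∫ s in (0 : ℝ)..t, w s)

theorem intervalIntegral_lp_add {E : Type*} [NormedAddCommGroup E] [NormedSpace ℝ E]
    (f g : Lp E 2 timeMeasure) {t : ℝ} (ht : t ∈ Icc (0 : ℝ) 1) :
    ∫ s in (0 : ℝ)..t, (f + g : Lp E 2 timeMeasure) s =
      (∫ s in (0 : ℝ)..t, f s) + ∫ s in (0 : ℝ)..t, g s :=
  map_add (primitiveCLM E ⟨t, ht⟩) f g

theorem intervalIntegral_lp_smul {E : Type*} [NormedAddCommGroup E] [NormedSpace ℝ E]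
    (c : ℝ) (f : Lp E 2 timeMeasure) {t : ℝ} (ht : t ∈ Icc (0 : ℝ) 1) :
    ∫ s in (0 : ℝ)..t, (c • f : Lp E 2 timeMeasure) s = c • ∫ s in (0 : ℝ)..t, f s :=
  map_smul (primitiveCLM E ⟨t, ht⟩) c f

theorem ae_time_mem : ∀ᵐ t ∂timeMeasure, t ∈ Icc (0 : ℝ) 1 := by
  filter_upwards [ae_restrict_mem measurableSet_Ioo] with t ht using Ioo_subset_Icc_self ht

theorem contToLp_ae_mem {E : Type*} [NormedAddCommGroup E] [NormedSpace ℝ E]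
    (r : C(Icc (0 : ℝ) 1, E)) :
    ∀ᵐ t ∂timeMeasure, ∀ ht : t ∈ Icc (0 : ℝ) 1, contToLp E r t = r ⟨t, ht⟩ := by
  filter_upwards [contToLp_ae r] with t ht ht'
  rw [ht, IccExtend_of_mem _ _ ht']

/-- Triples which are primitives, with initial value in `V`, of functions in `L²(I; V)`. -/
def regularSpace (ι : V →L[ℝ] H) : Submodule ℝ (Triple V H) where
  carrier := {z | ∃ v w, IsRegular ι v w z}
  zero_mem' := by
    refine ⟨0, 0, ?_, ?_, fun t => ?_⟩
    · filter_upwards with t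
      simp
    · filter_upwards with t
      simp
    · simp
  add_mem' := by
    rintro z z' ⟨v, w, h1, h2, h3⟩ ⟨v', w', h1', h2', h3'⟩
    refine ⟨v + v', w + w', ?_, ?_, fun t => ?_⟩
    · filter_upwards [h1, h1', Lp.coeFn_add z.1 z'.1, ae_time_mem] with t h h' h'' ht
      rw [Prod.fst_add, h'', Pi.add_apply, h, h', intervalIntegral_lp_add _ _ ht]
      abel
    · filter_upwards [h2, h2', Lp.coeFn_add z.2.1 z'.2.1, Lp.coeFn_add w w'] with t h h' h'' ht
      rw [Prod.snd_add, Prod.fst_add, h'', Pi.add_apply, h, h', ht]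
      simp
    · rw [Prod.snd_add, Prod.snd_add, ContinuousMap.add_apply, h3, h3',
        intervalIntegral_lp_add _ _ t.2, ← map_add]
      congr 1
      abel
  smul_mem' := by
    rintro c z ⟨v, w, h1, h2, h3⟩
    refine ⟨c • v, c • w, ?_, ?_, fun t => ?_⟩
    · filter_upwards [h1, Lp.coeFn_smul c z.1, ae_time_mem] with t h h'' ht
      rw [Prod.smul_fst, h'', Pi.smul_apply, h, intervalIntegral_lp_smul _ _ ht, smul_add]
    · filter_upwards [h2, Lp.coeFn_smul c z.2.1, Lp.coeFn_smul c w] with t h h'' ht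
      rw [Prod.smul_snd, Prod.smul_fst, h'', Pi.smul_apply, h, ht]
      simp
    · rw [Prod.smul_snd, Prod.smul_snd, ContinuousMap.smul_apply, h3,
        intervalIntegral_lp_smul _ _ t.2, ← smul_add, map_smul]

/-- The continuous function `v + ∫₀ᵗ w`. -/
noncomputable def primitiveMap {E : Type*} [NormedAddCommGroup E] [NormedSpace ℝ E] (v : E)
    (w : Lp E 2 timeMeasure) : C(Icc (0 : ℝ) 1, E) :=
  ⟨fun t => v + ∫ s in (0 : ℝ)..t, w s, by
    exact (continuousOn_const.add
      (continuousOn_primitive_Icc (lp_intervalIntegrable w))).domRestrict⟩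

theorem exists_isRegular (ι : V →L[ℝ] H) (v : V) (w : Lp V 2 timeMeasure) :
    ∃ z : Triple V H, IsRegular ι v w z := by
  refine ⟨(contToLp V (primitiveMap v w), (embDual ι).compLp w,
    (ContinuousMap.mk ι ι.continuous).comp (primitiveMap v w)), ?_, ?_, fun t => rfl⟩
  · filter_upwards [contToLp_ae_mem (primitiveMap v w), ae_time_mem] with t h ht
    exact h ht
  · exact (embDual ι).coeFn_compLp w

/-- The closure of the regular triples; by construction a model of `W(0,1)`. -/
noncomputable def evolutionSpace (ι : V →L[ℝ] H) : Submodule ℝ (Triple V H) :=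
  (regularSpace ι).topologicalClosure

/-- Closed conditions need only be checked on regular triples, where the functions are genuine
`V`-valued primitives and ordinary calculus applies. -/
theorem evolutionSpace_induction {ι : V →L[ℝ] H} {p : Triple V H → Prop}
    (hp : IsClosed {z | p z}) (h : ∀ v w z, IsRegular ι v w z → p z) {z : Triple V H}
    (hz : z ∈ evolutionSpace ι) : p z := by
  have : closure (regularSpace ι : Set (Triple V H)) ⊆ {z | p z} :=
    closure_minimal (by rintro z ⟨v, w, hz⟩; exact h v w z hz) hp
  exact this hz

theorem evolutionSpace_rep_ae {ι : V →L[ℝ] H} {z : Triple V H} (hz : z ∈ evolutionSpace ι) :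
    ∀ᵐ t ∂timeMeasure, ∀ ht : t ∈ Icc (0 : ℝ) 1, z.2.2 ⟨t, ht⟩ = ι (z.1 t) := by
  have h : contToLp H z.2.2 = ι.compLpL 2 timeMeasure z.1 := by
    refine evolutionSpace_induction (p := fun z => contToLp H z.2.2 = ι.compLpL 2 timeMeasure z.1)
      (isClosed_eq (by fun_prop) (by fun_prop)) ?_ hz
    rintro v w z ⟨h1, -, h3⟩
    apply Lp.ext
    filter_upwards [h1, ι.coeFn_compLpL (p := 2) z.1, contToLp_ae_mem z.2.2, ae_time_mem]
      with t h h' h'' ht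
    rw [h'' ht, h', h, h3]
  filter_upwards [ι.coeFn_compLpL (p := 2) z.1, contToLp_ae_mem z.2.2] with t h1 h2 ht
  rw [← h2 ht, h, h1]

theorem evolutionSpace_primitive [CompleteSpace V] {ι : V →L[ℝ] H} {z : Triple V H}
    (hz : z ∈ evolutionSpace ι) (t : Icc (0 : ℝ) 1) :
    toDualV ι (z.2.2 t) = toDualV ι (z.2.2 0) + ∫ s in (0 : ℝ)..t, z.2.1 s := by
  rw [← primitiveCLM_apply]
  refine evolutionSpace_induction (p := fun z => toDualV ι (z.2.2 t) =
    toDualV ι (z.2.2 0) + primitiveCLM (StrongDual ℝ V) t z.2.1)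
    (isClosed_eq (by fun_prop) (by fun_prop)) ?_ hz
  rintro v w z ⟨-, h2, h3⟩
  rw [primitiveCLM_apply, intervalIntegral_congr_time h2 (by simp) t.2,
    (embDual ι).intervalIntegral_comp_comm
    ((lp_intervalIntegrable w).mono_zero_one (by simp) t.2), h3, h3]
  simp [embDual]

/-- The pairing `⟨g, y⟩` integrated over `(0, t)`. -/
noncomputable abbrev pairing (t : Icc (0 : ℝ) 1) :
    Lp (StrongDual ℝ V) 2 timeMeasure →L[ℝ] Lp V 2 timeMeasure →L[ℝ] ℝ :=
  integralBilin (ContinuousLinearMap.id ℝ (StrongDual ℝ V)) t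

theorem pairing_apply (t : Icc (0 : ℝ) 1) (g : Lp (StrongDual ℝ V) 2 timeMeasure)
    (y : Lp V 2 timeMeasure) : pairing t g y = ∫ s in (0 : ℝ)..t, g s (y s) := rfl

theorem pairing_le (t : Icc (0 : ℝ) 1) (g : Lp (StrongDual ℝ V) 2 timeMeasure)
    (y : Lp V 2 timeMeasure) : pairing t g y ≤ ‖g‖ * ‖y‖ := by
  have := norm_intervalIntegral_bilin_le (ContinuousLinearMap.id ℝ (StrongDual ℝ V)) g y t.2
  have h1 : ‖ContinuousLinearMap.id ℝ (StrongDual ℝ V)‖ ≤ 1 := ContinuousLinearMap.norm_id_le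
  calc pairing t g y ≤ ‖ContinuousLinearMap.id ℝ (StrongDual ℝ V)‖ * ‖g‖ * ‖y‖ :=
        (le_abs_self _).trans this
    _ ≤ 1 * ‖g‖ * ‖y‖ := by gcongr
    _ = _ := by ring

/-- The energy identity. -/
theorem evolutionSpace_energy [CompleteSpace V] {ι : V →L[ℝ] H} {z : Triple V H}
    (hz : z ∈ evolutionSpace ι) (t : Icc (0 : ℝ) 1) :
    ‖z.2.2 t‖ ^ 2 = ‖z.2.2 0‖ ^ 2 + 2 * pairing t z.2.1 z.1 := by
  refine evolutionSpace_induction (p := fun z => ‖z.2.2 t‖ ^ 2 =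
    ‖z.2.2 0‖ ^ 2 + 2 * pairing t z.2.1 z.1)
    (isClosed_eq (by fun_prop) (by fun_prop)) ?_ hz
  rintro v w z ⟨h1, h2, h3⟩
  have hw := lp_intervalIntegrable w
  have key := bilin_primitive (embDual ι) hw hw v v t.2
  rw [pairing_apply, h3, h3, ← real_inner_self_eq_norm_sq, ← real_inner_self_eq_norm_sq,
    ← embDual_apply, key, ← embDual_apply, ← intervalIntegral.integral_const_mul]
  congr 1
  · simp
  refine intervalIntegral_congr_time ?_ (by simp) t.2
  filter_upwards [h1, h2] with s h1 h2
  rw [h1, h2, embDual_apply, embDual_apply, real_inner_comm (ι (w s)), two_mul]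

/-- The operator `y ↦ (∂ₜ y + b y, y(0))`. -/
noncomputable def evolutionOp (V H : Type*) [NormedAddCommGroup V] [InnerProductSpace ℝ V]
    [NormedAddCommGroup H] [InnerProductSpace ℝ H] (b : V →L[ℝ] StrongDual ℝ V) :
    Triple V H →L[ℝ] Lp (StrongDual ℝ V) 2 timeMeasure × H :=
  ((ContinuousLinearMap.fst ℝ _ _).comp (ContinuousLinearMap.snd ℝ _ _) +
    (b.compLpL 2 timeMeasure).comp (ContinuousLinearMap.fst ℝ _ _)).prod
  ((ContinuousMap.evalCLM ℝ 0).comp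
    ((ContinuousLinearMap.snd ℝ _ _).comp (ContinuousLinearMap.snd ℝ _ _)))

theorem evolutionOp_apply (b : V →L[ℝ] StrongDual ℝ V) (z : Triple V H) :
    evolutionOp V H b z = (z.2.1 + b.compLpL 2 timeMeasure z.1, z.2.2 0) := rfl

end Evolution

end MinDistance

namespace MinDistance
open Filter Topology

/-! ### A priori estimate and uniqueness for the homogeneous equations. -/

section Parabolic

variable {V H : Type*}
  [NormedAddCommGroup V] [InnerProductSpace ℝ V] [CompleteSpace V]
  [NormedAddCommGroup H] [InnerProductSpace ℝ H]

/-- The constant of the a priori estimate. -/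
noncomputable def aprioriConst (α ω : ℝ) : ℝ :=
  6 * (Real.exp (2 * ω) + (1 + 2 * ω * Real.exp (2 * ω)) / (2 * α))

theorem aprioriConst_nonneg {α ω : ℝ} (hα : 0 < α) (hω : 0 ≤ ω) : 0 ≤ aprioriConst α ω := by
  unfold aprioriConst
  positivity

omit [InnerProductSpace ℝ V] [CompleteSpace V] in
theorem norm_sq_intervalIntegrable (y : Lp V 2 timeMeasure) :
    IntervalIntegrable (fun t => ‖y t‖ ^ 2) volume 0 1 :=
  intervalIntegrable_zero_one_iff.2
    ((memLp_two_iff_integrable_sq_norm (Lp.memLp y).1).1 (Lp.memLp y))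

/-- The a priori estimate for `∂ₜ y + b y = G`. -/
theorem evolutionSpace_apriori {ι : V →L[ℝ] H} {b : V →L[ℝ] StrongDual ℝ V} {α ω κ : ℝ}
    (hα : 0 < α) (hω : 0 ≤ ω) (hκ : 0 ≤ κ)
    (hb : ∀ v, α * ‖v‖ ^ 2 ≤ b v v + ω * ‖ι v‖ ^ 2) {z : Triple V H}
    (hz : z ∈ evolutionSpace ι)
    (hG : ∀ t, pairing t (evolutionOp V H b z).1 z.1 ≤ κ * (‖z.2.2‖ + ‖z.1‖))
    (h0 : ‖z.2.2 0‖ ≤ κ) : ‖z.2.2‖ + ‖z.1‖ ≤ aprioriConst α ω * κ := by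
  set Q := ‖z.2.2‖ + ‖z.1‖ with hQ
  have hQ0 : 0 ≤ Q := by positivity
  set φ : ℝ → ℝ := fun t => ‖IccExtend zero_le_one z.2.2 t‖ ^ 2 with hφ
  have hφc : Continuous φ := by
    have : Continuous (IccExtend (zero_le_one (α := ℝ)) z.2.2) := z.2.2.continuous.Icc_extend'
    exact this.norm.pow 2
  have hφe : ∀ t : Icc (0 : ℝ) 1, φ t = ‖z.2.2 t‖ ^ 2 := fun t => by simp [hφ]
  have hφy : ∀ᵐ t ∂timeMeasure, φ t = ‖ι (z.1 t)‖ ^ 2 := by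
    filter_upwards [evolutionSpace_rep_ae hz, ae_time_mem] with t h ht
    rw [← h ht]
    exact hφe ⟨t, ht⟩
  -- The factor `3` collects one `κ * Q` from the initial value and two from the doubled pairing in
  -- the energy identity.
  have main : ∀ t : Icc (0 : ℝ) 1, φ t + 2 * α * ∫ s in (0 : ℝ)..t, ‖z.1 s‖ ^ 2 ≤
      3 * κ * Q + 2 * ω * ∫ s in (0 : ℝ)..t, φ s := by
    intro t
    have h1 := evolutionSpace_energy hz t
    have h00 : (0 : ℝ) ∈ Icc (0 : ℝ) 1 := by simp
    have hi1 := (norm_sq_intervalIntegrable z.1).mono_zero_one h00 t.2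
    have hi2 : IntervalIntegrable φ volume 0 t := hφc.intervalIntegrable _ _
    have hi3 : IntervalIntegrable (fun s => b (z.1 s) (z.1 s)) volume 0 t :=
      (intervalIntegrable_zero_one_iff.2 (integrable_bilin b z.1 z.1)).mono_zero_one (by simp) t.2
    have h2 : α * (∫ s in (0 : ℝ)..t, ‖z.1 s‖ ^ 2) - ω * (∫ s in (0 : ℝ)..t, φ s) ≤
        ∫ s in (0 : ℝ)..t, b (z.1 s) (z.1 s) := by
      rw [← intervalIntegral.integral_const_mul, ← intervalIntegral.integral_const_mul,
        ← intervalIntegral.integral_sub (hi1.const_mul α) (hi2.const_mul ω)]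
      refine intervalIntegral.integral_mono_ae_restrict t.2.1
        ((hi1.const_mul α).sub (hi2.const_mul ω)) hi3 ?_
      rw [EventuallyLE, ae_restrict_iff' measurableSet_Icc]
      filter_upwards [ae_time_iff.1 hφy] with s hs hs'
      rw [hs ⟨hs'.1, hs'.2.trans t.2.2⟩]
      linarith [hb (z.1 s)]
    have h3 : pairing t (evolutionOp V H b z).1 z.1 =
        pairing t z.2.1 z.1 + ∫ s in (0 : ℝ)..t, b (z.1 s) (z.1 s) := by
      rw [evolutionOp_apply, map_add, add_apply]
      congr 1
      refine intervalIntegral_congr_time ?_ (by simp) t.2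
      filter_upwards [b.coeFn_compLpL (p := 2) z.1] with s hs
      rw [hs]
      rfl
    have h4 := hG t
    have h5 : ‖z.2.2 0‖ ^ 2 ≤ κ * Q := by
      rw [sq]
      exact mul_le_mul h0 ((z.2.2.norm_coe_le_norm 0).trans (by simp [hQ])) (norm_nonneg _) hκ
    rw [hφe t, h1]
    linarith
  have hgr := gronwall_unit (φ := φ) (K := 3 * κ * Q) (c := 2 * ω) (by positivity) (by positivity)
    hφc.continuousOn fun t ht => by
      have := main ⟨t, ht⟩
      have h2 := intervalIntegral.integral_nonneg (μ := volume) ht.1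
        (f := fun s => ‖z.1 s‖ ^ 2) fun s _ => sq_nonneg _
      have h3 := mul_nonneg (mul_nonneg two_pos.le hα.le) h2
      linarith
  have hr : ‖z.2.2‖ ^ 2 ≤ 3 * κ * Q * Real.exp (2 * ω) := by
    have hnn : 0 ≤ 3 * κ * Q * Real.exp (2 * ω) := by positivity
    rw [← Real.sq_sqrt hnn]
    refine pow_le_pow_left₀ (norm_nonneg _) ?_ 2
    rw [ContinuousMap.norm_le _ (Real.sqrt_nonneg _)]
    intro t
    refine Real.le_sqrt_of_sq_le ?_
    rw [← hφe]
    exact hgr t t.2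
  have hy : 2 * α * ‖z.1‖ ^ 2 ≤ 3 * κ * Q + 2 * ω * (3 * κ * Q * Real.exp (2 * ω)) := by
    have h1 := main 1
    rw [norm_sq_lp_eq]
    have h2 : ∫ s in (0 : ℝ)..1, φ s ≤ 3 * κ * Q * Real.exp (2 * ω) := by
      calc ∫ s in (0 : ℝ)..1, φ s ≤ ∫ s in (0 : ℝ)..1, 3 * κ * Q * Real.exp (2 * ω) :=
            intervalIntegral.integral_mono_on zero_le_one (hφc.intervalIntegrable _ _)
              (by simp) fun s hs => hgr s hs
        _ = _ := by simp
    have h3 : 0 ≤ φ (1 : Icc (0 : ℝ) 1) := sq_nonneg _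
    have h4 := mul_le_mul_of_nonneg_left h2 (mul_nonneg two_pos.le hω)
    simp only [Icc.coe_one] at h1 h3
    linarith
  have hy' : ‖z.1‖ ^ 2 ≤ 3 * κ * Q * ((1 + 2 * ω * Real.exp (2 * ω)) / (2 * α)) := by
    rw [mul_div_assoc', le_div_iff₀ (by positivity)]
    linarith
  -- The right-hand side was bounded by `κ` times the unknown `Q` itself, so the quadratic estimate
  -- becomes linear after cancelling one `Q`.
  have hfin : Q * Q ≤ (aprioriConst α ω * κ) * Q := by
    have : Q * Q ≤ 2 * (‖z.2.2‖ ^ 2 + ‖z.1‖ ^ 2) := by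
      rw [hQ]
      nlinarith [sq_nonneg (‖z.2.2‖ - ‖z.1‖)]
    unfold aprioriConst
    linarith
  rcases hQ0.eq_or_lt with h | h
  · rw [← h]
    exact mul_nonneg (aprioriConst_nonneg hα hω) hκ
  · exact le_of_mul_le_mul_right hfin h

omit [CompleteSpace V] in
/-- A primitive `Q = e + ∫₀ᵗ q` with `(ι q, ι v) = ∓ b(Q, v)` which vanishes at one end point of
the time interval vanishes identically. -/
theorem ae_eq_zero_of_primitive_eq {ι : V →L[ℝ] H} (hι : Function.Injective ι)
    {c : V →L[ℝ] StrongDual ℝ V} {e : V} {q : Lp V 2 timeMeasure}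
    (hq : ∀ᵐ t ∂timeMeasure, ∀ v, inner ℝ (ι (q t)) (ι v) =
      c (e + ∫ s in (0 : ℝ)..t, q s) v)
    (hQ : ∀ t ∈ Icc (0 : ℝ) 1, ι (e + ∫ s in (0 : ℝ)..t, q s) = 0) : q = 0 := by
  have hQ' : ∀ t ∈ Icc (0 : ℝ) 1, e + ∫ s in (0 : ℝ)..t, q s = 0 := fun t ht =>
    hι ((hQ t ht).trans (map_zero ι).symm)
  apply Lp.ext
  filter_upwards [hq, ae_time_mem, Lp.coeFn_zero V 2 timeMeasure] with t h ht h0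
  rw [h0]
  have := h (q t)
  rw [hQ' t ht, map_zero, real_inner_self_eq_norm_sq] at this
  simp only [zero_apply, ne_eq, OfNat.ofNat_ne_zero, not_false_eq_true,
    pow_eq_zero_iff, norm_eq_zero] at this
  exact hι (this.trans (map_zero ι).symm)

theorem norm_sq_primitive {ι : V →L[ℝ] H} (e : V) (q : Lp V 2 timeMeasure) {t : ℝ}
    (ht : t ∈ Icc (0 : ℝ) 1) :
    ‖ι (e + ∫ s in (0 : ℝ)..t, q s)‖ ^ 2 = ‖ι e‖ ^ 2 +
      2 * ∫ s in (0 : ℝ)..t, inner ℝ (ι (q s)) (ι (e + ∫ r in (0 : ℝ)..s, q r)) := by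
  have hq := lp_intervalIntegrable q
  rw [← real_inner_self_eq_norm_sq, ← real_inner_self_eq_norm_sq, ← embDual_apply,
    bilin_primitive (embDual ι) hq hq e e ht, ← embDual_apply,
    ← intervalIntegral.integral_const_mul]
  congr 1
  refine intervalIntegral.integral_congr fun s _ => ?_
  simp only [embDual_apply]
  rw [real_inner_comm (ι (q s)), two_mul]

omit [CompleteSpace V] in
theorem continuousOn_primitive_const_add (e : V) (q : Lp V 2 timeMeasure) :
    ContinuousOn (fun t => e + ∫ s in (0 : ℝ)..t, q s) (Icc 0 1) :=
  continuousOn_const.add (continuousOn_primitive_Icc (lp_intervalIntegrable q))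

/-- Uniqueness for the homogeneous forward equation. -/
theorem forward_eq_zero {ι : V →L[ℝ] H} (hι : Function.Injective ι)
    {b : V →L[ℝ] StrongDual ℝ V} {ω : ℝ} (hω : 0 ≤ ω)
    (hb : ∀ v, 0 ≤ b v v + ω * ‖ι v‖ ^ 2) {q : Lp V 2 timeMeasure}
    (hq : ∀ᵐ t ∂timeMeasure, ∀ v, inner ℝ (ι (q t)) (ι v) =
      - b (∫ s in (0 : ℝ)..t, q s) v) : q = 0 := by
  set Q : ℝ → V := fun t => 0 + ∫ s in (0 : ℝ)..t, q s with hQ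
  have hQc : ContinuousOn Q (Icc 0 1) := continuousOn_primitive_const_add 0 q
  have hq' : ∀ᵐ t ∂timeMeasure, ∀ v, inner ℝ (ι (q t)) (ι v) = (-b) (Q t) v := by
    filter_upwards [hq] with t h v
    simp [hQ, h]
  refine ae_eq_zero_of_primitive_eq hι hq' fun t ht => ?_
  have hQn : ContinuousOn (fun t => ‖ι (Q t)‖ ^ 2) (Icc 0 1) :=
    (ι.continuous.comp_continuousOn hQc).norm.pow 2
  have hbc : ContinuousOn (fun t => b (Q t) (Q t)) (Icc 0 1) :=
    (b.continuous.comp_continuousOn hQc).clm_apply hQc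
  have := gronwall_unit (φ := fun t => ‖ι (Q t)‖ ^ 2) (K := 0) (c := 2 * ω) (by positivity) le_rfl
    hQn (fun t ht => by
      have h0 : (0 : ℝ) ∈ Icc (0 : ℝ) 1 := by simp
      have hsub : Icc 0 t ⊆ Icc (0 : ℝ) 1 := Icc_subset_Icc le_rfl ht.2
      change ‖ι (0 + ∫ s in (0 : ℝ)..t, q s)‖ ^ 2 ≤ _
      rw [norm_sq_primitive 0 q ht, intervalIntegral_congr_time (g := fun s => - b (Q s) (Q s))
        (by filter_upwards [hq'] with s hs; exact hs (Q s)) h0 ht]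
      have h2 : ∫ s in (0 : ℝ)..t, - b (Q s) (Q s) ≤ ∫ s in (0 : ℝ)..t, ω * ‖ι (Q s)‖ ^ 2 :=
        intervalIntegral.integral_mono_on ht.1
          ((hbc.neg.mono hsub).intervalIntegrable_of_Icc ht.1)
          (((continuousOn_const.mul hQn).mono hsub).intervalIntegrable_of_Icc ht.1)
          fun s hs => by linarith [hb (Q s)]
      rw [intervalIntegral.integral_const_mul] at h2
      simp only [map_zero, norm_zero]
      linarith) t ht
  rw [zero_mul] at this
  have h0 := le_antisymm this (sq_nonneg _)
  exact norm_eq_zero.1 ((pow_eq_zero_iff two_ne_zero).1 h0)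

/-- Uniqueness for the homogeneous backward equation. -/
theorem backward_eq_zero {ι : V →L[ℝ] H} (hι : Function.Injective ι)
    {b : V →L[ℝ] StrongDual ℝ V} {ω : ℝ} (hω : 0 ≤ ω)
    (hb : ∀ v, 0 ≤ b v v + ω * ‖ι v‖ ^ 2) {e : V} {q : Lp V 2 timeMeasure}
    (he : e + ∫ s in (0 : ℝ)..1, q s = 0)
    (hq : ∀ᵐ t ∂timeMeasure, ∀ v, inner ℝ (ι (q t)) (ι v) =
      b v (e + ∫ s in (0 : ℝ)..t, q s)) : q = 0 := by
  set Q : ℝ → V := fun t => e + ∫ s in (0 : ℝ)..t, q s with hQ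
  have hQc : ContinuousOn Q (Icc 0 1) := continuousOn_primitive_const_add e q
  refine ae_eq_zero_of_primitive_eq (c := b.flip) (e := e) hι hq fun t ht => ?_
  have hQn : ContinuousOn (fun t => ‖ι (Q t)‖ ^ 2) (Icc 0 1) :=
    (ι.continuous.comp_continuousOn hQc).norm.pow 2
  have hbc : ContinuousOn (fun t => b (Q t) (Q t)) (Icc 0 1) :=
    (b.continuous.comp_continuousOn hQc).clm_apply hQc
  have h0 : (0 : ℝ) ∈ Icc (0 : ℝ) 1 := by simp
  have h1 : (1 : ℝ) ∈ Icc (0 : ℝ) 1 := by simp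
  have hsq : ∀ t ∈ Icc (0 : ℝ) 1, ‖ι (Q t)‖ ^ 2 = ‖ι e‖ ^ 2 +
      2 * ∫ s in (0 : ℝ)..t, b (Q s) (Q s) := fun t ht => by
    change ‖ι (e + ∫ s in (0 : ℝ)..t, q s)‖ ^ 2 = _
    rw [norm_sq_primitive e q ht, intervalIntegral_congr_time (g := fun s => b (Q s) (Q s))
        (by filter_upwards [hq] with s hs; exact hs (Q s)) h0 ht]
  have := gronwall_unit_backward (φ := fun t => ‖ι (Q t)‖ ^ 2) (c := 2 * ω) (by positivity)
    hQn (fun t ht => by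
      have hsub : Icc t 1 ⊆ Icc (0 : ℝ) 1 := Icc_subset_Icc ht.1 le_rfl
      have hI := intervalIntegral.integral_add_adjacent_intervals (μ := volume)
        ((hbc.intervalIntegrable_of_Icc zero_le_one).mono_zero_one h0 ht)
        ((hbc.intervalIntegrable_of_Icc zero_le_one).mono_zero_one ht h1)
      have e1 := hsq 1 h1
      have e2 := hsq t ht
      have hQ1 : Q 1 = 0 := he
      rw [hQ1, map_zero, norm_zero, ← hI] at e1
      -- As `Q` vanishes at time `1`, `‖ι (Q t)‖ ^ 2` is twice the integral of `-b (Q, Q)` over `(t,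
      -- 1)`, where Gårding has the favourable sign.
      have h2 : ∫ s in t..1, - b (Q s) (Q s) ≤ ∫ s in t..1, ω * ‖ι (Q s)‖ ^ 2 :=
        intervalIntegral.integral_mono_on ht.2
          ((hbc.neg.mono hsub).intervalIntegrable_of_Icc ht.2)
          (((continuousOn_const.mul hQn).mono hsub).intervalIntegrable_of_Icc ht.2)
          fun s hs => by linarith [hb (Q s)]
      rw [intervalIntegral.integral_const_mul, intervalIntegral.integral_neg] at h2
      linarith) t ht
  have h0 := le_antisymm this (sq_nonneg _)
  exact norm_eq_zero.1 ((pow_eq_zero_iff two_ne_zero).1 h0)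

end Parabolic

end MinDistance

namespace MinDistance
open Filter Topology

/-! ### Existence by closed and dense range, uniqueness, and identification with `W(0,1)`. -/

section Solvability

variable {V H : Type*}
  [NormedAddCommGroup V] [InnerProductSpace ℝ V] [CompleteSpace V]
  [NormedAddCommGroup H] [InnerProductSpace ℝ H]

/-- The Riesz isomorphism `V* → V` as a continuous linear map. -/
noncomputable def rieszCLM (V : Type*) [NormedAddCommGroup V] [InnerProductSpace ℝ V]
    [CompleteSpace V] : StrongDual ℝ V →L[ℝ] V :=
  LinearMap.mkContinuous
    { toFun := (InnerProductSpace.toDual ℝ V).symm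
      map_add' := fun f g => map_add _ f g
      map_smul' := fun c f => by simp }
    1 fun f => by simp

theorem inner_rieszCLM (f : StrongDual ℝ V) (v : V) : inner ℝ (rieszCLM V f) v = f v :=
  InnerProductSpace.toDual_symm_apply

/-- Density of the range. With `Q` the primitive of `q` vanishing at time `1`, the annihilation
property says that `Q` solves a homogeneous backward equation, so `q = 0`; triples constant in time
then kill `l`, because `ι` has dense range. -/
theorem annihilator_eq_zero {ι : V →L[ℝ] H} (hι : Function.Injective ι) (hd : DenseRange ι)
    {b : V →L[ℝ] StrongDual ℝ V} {ω : ℝ} (hω : 0 ≤ ω)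
    (hb : ∀ v, 0 ≤ b v v + ω * ‖ι v‖ ^ 2) {q : Lp V 2 timeMeasure} {l : StrongDual ℝ H}
    (h : ∀ v w z, IsRegular ι v w z → pairing 1 (evolutionOp V H b z).1 q + l (z.2.2 0) = 0) :
    q = 0 ∧ l = 0 := by
  have h0 : (0 : ℝ) ∈ Icc (0 : ℝ) 1 := by simp
  have h1 : (1 : ℝ) ∈ Icc (0 : ℝ) 1 := by simp
  set e : V := - ∫ s in (0 : ℝ)..1, q s with he
  set QL : Lp V 2 timeMeasure := contToLp V (primitiveMap e q) with hQL
  have hQLae : ∀ᵐ t ∂timeMeasure, QL t = e + ∫ s in (0 : ℝ)..t, q s := by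
    filter_upwards [contToLp_ae_mem (primitiveMap e q), ae_time_mem] with t ht ht'
    rw [hQL, ht ht']
    rfl
  -- The Riesz representative of the residual of the backward equation for `Q`. The residual is
  -- tested with itself: the regular triple with zero initial value and derivative `K`.
  set K : Lp V 2 timeMeasure := ((rieszCLM V).comp (embDual ι)).compLp q -
    ((rieszCLM V).comp b.flip).compLp QL with hK
  have hKae : ∀ᵐ t ∂timeMeasure, K t = rieszCLM V (embDual ι (q t)) -
      rieszCLM V (b.flip (QL t)) := by
    filter_upwards [Lp.coeFn_sub (((rieszCLM V).comp (embDual ι)).compLp q)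
      (((rieszCLM V).comp b.flip).compLp QL), ((rieszCLM V).comp (embDual ι)).coeFn_compLp q,
      ((rieszCLM V).comp b.flip).coeFn_compLp QL] with t e1 e2 e3
    rw [hK, e1, Pi.sub_apply, e2, e3]
    rfl
  have hC : ∀ w : Lp V 2 timeMeasure, inner ℝ K w =
      integralBilin (embDual ι) 1 w q - integralBilin b 1 w QL := by
    intro w
    rw [L2.inner_def, integral_timeMeasure, integralBilin_apply, integralBilin_apply, Icc.coe_one,
      ← intervalIntegral.integral_sub
        (intervalIntegrable_zero_one_iff.2 (integrable_bilin _ w q))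
        (intervalIntegrable_zero_one_iff.2 (integrable_bilin _ w QL))]
    refine intervalIntegral_congr_time ?_ h0 h1
    filter_upwards [hKae] with t ht
    rw [ht, inner_sub_left, inner_rieszCLM, inner_rieszCLM, embDual_apply, embDual_apply,
      real_inner_comm]
    rfl
  have hKzero : K = 0 := by
    obtain ⟨z, hz⟩ := exists_isRegular ι 0 K
    have hA : integralBilin (embDual ι) 1 K q + integralBilin b 1 z.1 q = 0 := by
      refine Eq.trans ?_ (h 0 K z hz)
      rw [hz.2.2 0]
      simp only [Icc.coe_zero, intervalIntegral.integral_same, add_zero, map_zero]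
      rw [evolutionOp_apply, map_add, add_apply]
      congr 1
      · refine intervalIntegral_congr_time ?_ h0 (by simp)
        filter_upwards [hz.2.1] with t ht
        rw [ht]
        rfl
      · refine intervalIntegral_congr_time ?_ h0 (by simp)
        filter_upwards [b.coeFn_compLpL (p := 2) z.1] with t ht
        rw [ht]
        rfl
    -- Integration by parts of `b(z, Q)` leaves no boundary terms, as `z` vanishes at `0` and `Q` at
    -- `1`. Subtracting this from `hA` gives `⟪K, K⟫ = 0`.
    have hB : integralBilin b 1 K QL + integralBilin b 1 z.1 q = 0 := by
      rw [integralBilin_apply, integralBilin_apply, Icc.coe_one,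
        ← intervalIntegral.integral_add
        (intervalIntegrable_zero_one_iff.2 (integrable_bilin b K QL))
        (intervalIntegrable_zero_one_iff.2 (integrable_bilin b z.1 q))]
      have := bilin_primitive b (lp_intervalIntegrable K) (lp_intervalIntegrable q) 0 e h1
      rw [he, neg_add_cancel, map_zero, map_zero, zero_apply, zero_add, ← he] at this
      refine Eq.trans ?_ this.symm
      refine intervalIntegral_congr_time ?_ h0 h1
      filter_upwards [hQLae, hz.1] with t e1 e2
      rw [e1, e2]
    have := hC K
    rw [← inner_self_eq_zero (𝕜 := ℝ), this]
    linarith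
  have hq : q = 0 := by
    refine backward_eq_zero (e := e) hι hω hb (by rw [he, neg_add_cancel]) ?_
    filter_upwards [hKae, hQLae, Lp.coeFn_zero V 2 timeMeasure] with t e1 e2 e3 v
    rw [hKzero, e3] at e1
    have : inner ℝ (rieszCLM V (embDual ι (q t)) - rieszCLM V (b.flip (QL t))) v = 0 := by
      rw [← e1]
      simp
    rw [inner_sub_left, inner_rieszCLM, inner_rieszCLM, e2, embDual_apply, sub_eq_zero] at this
    exact this
  refine ⟨hq, ?_⟩
  have : (l : H → ℝ) = fun _ => 0 := by
    refine hd.equalizer l.continuous continuous_const (funext fun v => ?_)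
    obtain ⟨z, hz⟩ := exists_isRegular ι v 0
    have := h v 0 z hz
    rw [hq, map_zero, zero_add, hz.2.2 0] at this
    simpa using this
  ext x
  exact congrFun this x

instance [CompleteSpace H] (ι : V →L[ℝ] H) : CompleteSpace (evolutionSpace ι) :=
  (Submodule.isClosed_topologicalClosure (regularSpace ι)).completeSpace_coe

theorem norm_le_of_evolutionSpace {ι : V →L[ℝ] H} {b : V →L[ℝ] StrongDual ℝ V} {α ω : ℝ}
    (hα : 0 < α) (hω : 0 ≤ ω)
    (hb : ∀ v, α * ‖v‖ ^ 2 ≤ b v v + ω * ‖ι v‖ ^ 2) {z : Triple V H}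
    (hz : z ∈ evolutionSpace ι) :
    ‖z‖ ≤ (1 + (1 + ‖b‖) * aprioriConst α ω) * ‖evolutionOp V H b z‖ := by
  set N := ‖evolutionOp V H b z‖ with hN
  have hC := aprioriConst_nonneg hα hω
  have h1 : ‖(evolutionOp V H b z).1‖ ≤ N := norm_fst_le _
  have h2 : ‖z.2.2 0‖ ≤ N := norm_snd_le (evolutionOp V H b z)
  have hQ := evolutionSpace_apriori hα hω (norm_nonneg _) hb hz (κ := N) (fun t => by
    refine (pairing_le _ _ _).trans ?_
    have := mul_le_mul h1 (le_add_of_nonneg_left (norm_nonneg z.2.2)) (norm_nonneg z.1)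
      (norm_nonneg _)
    exact this) h2
  have hN0 : 0 ≤ N := norm_nonneg _
  have hr := norm_nonneg z.2.2
  have hy := norm_nonneg z.1
  have hCN : 0 ≤ aprioriConst α ω * N := mul_nonneg hC hN0
  have hbCN : 0 ≤ ‖b‖ * (aprioriConst α ω * N) := mul_nonneg (norm_nonneg b) hCN
  have hg : ‖z.2.1‖ ≤ N + ‖b‖ * ‖z.1‖ := by
    have e1 : z.2.1 = (evolutionOp V H b z).1 - b.compLpL 2 timeMeasure z.1 := by
      rw [evolutionOp_apply]
      simp
    rw [e1]
    refine (norm_sub_le _ _).trans (add_le_add h1 ?_)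
    exact ContinuousLinearMap.norm_compLp_le b z.1
  have hb1 : ‖b‖ * ‖z.1‖ ≤ ‖b‖ * (aprioriConst α ω * N) := by
    gcongr
    linarith
  rw [Prod.norm_def, Prod.norm_def]
  refine max_le ?_ (max_le ?_ ?_) <;> linarith

/-- The Riesz isomorphism carries `L²(I; V*)` to the Hilbert space `L²(I; V)`, where the functional
is represented by an inner product; no general duality of Bochner spaces is involved. -/
theorem exists_functional_repr (f : StrongDual ℝ (Lp (StrongDual ℝ V) 2 timeMeasure × H)) :
    ∃ (q : Lp V 2 timeMeasure) (l : StrongDual ℝ H), ∀ y, f y = pairing 1 y.1 q + l y.2 := by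
  let D : V →L[ℝ] StrongDual ℝ V := toDualV (ContinuousLinearMap.id ℝ V)
  let φ : StrongDual ℝ (Lp V 2 timeMeasure) :=
    (f.comp (ContinuousLinearMap.inl ℝ _ _)).comp (D.compLpL 2 timeMeasure)
  refine ⟨rieszCLM _ φ, f.comp (ContinuousLinearMap.inr ℝ _ _), fun y => ?_⟩
  have e1 : f y = f (y.1, 0) + f (0, y.2) := by
    rw [← map_add]
    simp
  have e2 : D.compLpL 2 timeMeasure ((rieszCLM V).compLp y.1) = y.1 := by
    apply Lp.ext
    filter_upwards [D.coeFn_compLpL (p := 2) ((rieszCLM V).compLp y.1),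
      (rieszCLM V).coeFn_compLp y.1] with t h1 h2
    rw [h1, h2]
    ext v
    exact inner_rieszCLM _ _
  have e3 : φ ((rieszCLM V).compLp y.1) = f (y.1, 0) := by
    change f (D.compLpL 2 timeMeasure ((rieszCLM V).compLp y.1), 0) = _
    rw [e2]
  have e4 : pairing 1 y.1 (rieszCLM _ φ) = φ ((rieszCLM V).compLp y.1) := by
    rw [← inner_rieszCLM φ, L2.inner_def, integral_timeMeasure, pairing_apply]
    refine intervalIntegral_congr_time ?_ (by simp) (by simp)
    filter_upwards [(rieszCLM V).coeFn_compLp y.1] with t h2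
    rw [h2, real_inner_comm, inner_rieszCLM]
  rw [e1, e4, e3]
  rfl

/-- The a priori estimate bounds the operator from below on a complete space, which forces closed
range. -/
theorem isClosed_evolutionOp_image [CompleteSpace H] {ι : V →L[ℝ] H}
    {b : V →L[ℝ] StrongDual ℝ V} {α ω : ℝ} (hα : 0 < α) (hω : 0 ≤ ω)
    (hb : ∀ v, α * ‖v‖ ^ 2 ≤ b v v + ω * ‖ι v‖ ^ 2) :
    IsClosed (evolutionOp V H b '' (evolutionSpace ι : Set (Triple V H))) := by
  have hC : 0 ≤ 1 + (1 + ‖b‖) * aprioriConst α ω := by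
    have := aprioriConst_nonneg hα hω
    positivity
  have hanti : AntilipschitzWith ⟨_, hC⟩
      ((evolutionOp V H b).comp (evolutionSpace ι).subtypeL) :=
    ContinuousLinearMap.antilipschitz_of_bound _
      fun z => norm_le_of_evolutionSpace hα hω hb z.2
  have := hanti.isClosed_range (ContinuousLinearMap.uniformContinuous _)
  rw [ContinuousLinearMap.coe_comp, range_comp] at this
  simpa using this

theorem evolutionOp_surjective [CompleteSpace H] {ι : V →L[ℝ] H} (hι : Function.Injective ι)
    (hd : DenseRange ι) {b : V →L[ℝ] StrongDual ℝ V} {α ω : ℝ} (hα : 0 < α) (hω : 0 ≤ ω)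
    (hb : ∀ v, α * ‖v‖ ^ 2 ≤ b v v + ω * ‖ι v‖ ^ 2)
    (x : Lp (StrongDual ℝ V) 2 timeMeasure × H) :
    ∃ z ∈ evolutionSpace ι, evolutionOp V H b z = x := by
  by_contra hx
  have hconv : Convex ℝ (evolutionOp V H b '' (evolutionSpace ι : Set (Triple V H))) :=
    (evolutionSpace ι).convex.is_linear_image ⟨map_add _, map_smul _⟩
  obtain ⟨f, u, hf, hu⟩ := geometric_hahn_banach_closed_point hconv
    (isClosed_evolutionOp_image hα hω hb) (x := x) hx
  have hu0 : 0 < u := by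
    have := hf _ ⟨0, (evolutionSpace ι).zero_mem, rfl⟩
    rwa [map_zero, map_zero] at this
  have hf0 : ∀ z ∈ evolutionSpace ι, f (evolutionOp V H b z) = 0 := by
    intro z hz
    by_contra hne
    -- A functional bounded above on a subspace vanishes there: rescaling `z` would attain the value
    -- `u`, which is strictly excluded.
    have := hf _ ⟨_, (evolutionSpace ι).smul_mem (u / f (evolutionOp V H b z)) hz, rfl⟩
    rw [map_smul, map_smul, smul_eq_mul, div_mul_cancel₀ _ hne] at this
    exact lt_irrefl _ this
  obtain ⟨q, l, hrep⟩ := exists_functional_repr f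
  obtain ⟨hq0, hl0⟩ := annihilator_eq_zero hι hd hω (b := b) (q := q) (l := l)
    (fun v => (by positivity : 0 ≤ α * ‖v‖ ^ 2).trans (hb v)) fun v w z hz => by
      have hz' : z ∈ evolutionSpace ι :=
        Submodule.le_topologicalClosure (regularSpace ι) ⟨v, w, hz⟩
      have := hf0 z hz'
      rwa [hrep] at this
  rw [hrep, hq0, hl0] at hu
  simp only [map_zero, zero_apply, add_zero] at hu
  exact lt_asymm hu hu0

/-- The function is the primitive of its candidate for the time derivative, and it is
represented by the continuous function. -/
structure IsPrimitive (ι : V →L[ℝ] H) (z : Triple V H) : Prop where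
  rep_ae : ∀ᵐ t ∂timeMeasure, ∀ ht : t ∈ Icc (0 : ℝ) 1, z.2.2 ⟨t, ht⟩ = ι (z.1 t)
  primitive : ∀ t : Icc (0 : ℝ) 1,
    toDualV ι (z.2.2 t) = toDualV ι (z.2.2 0) + ∫ s in (0 : ℝ)..t, z.2.1 s

theorem isPrimitive_of_mem {ι : V →L[ℝ] H} {z : Triple V H} (hz : z ∈ evolutionSpace ι) :
    IsPrimitive ι z :=
  ⟨evolutionSpace_rep_ae hz, evolutionSpace_primitive hz⟩

omit [CompleteSpace V] in
theorem IsPrimitive.sub {ι : V →L[ℝ] H} {z z' : Triple V H} (hz : IsPrimitive ι z)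
    (hz' : IsPrimitive ι z') : IsPrimitive ι (z - z') := by
  refine ⟨?_, fun t => ?_⟩
  · filter_upwards [hz.rep_ae, hz'.rep_ae, Lp.coeFn_sub z.1 z'.1] with t h1 h2 h3 ht
    rw [Prod.fst_sub, h3, Pi.sub_apply, map_sub, ← h1 ht, ← h2 ht]
    rfl
  · have h := map_sub (primitiveCLM (StrongDual ℝ V) t) z.2.1 z'.2.1
    simp only [primitiveCLM_apply] at h
    rw [Prod.snd_sub, Prod.snd_sub, Prod.fst_sub, h, ContinuousMap.sub_apply,
      ContinuousMap.sub_apply, map_sub, map_sub, hz.primitive, hz'.primitive]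
    abel

/-- The energy identity is not yet available for such triples. Integrating the equation in time
replaces `y` by its `V`-valued primitive, which satisfies the same equation and for which the chain
rule is elementary. -/
theorem IsPrimitive.eq_zero {ι : V →L[ℝ] H} (hι : Function.Injective ι) (hd : DenseRange ι)
    {b : V →L[ℝ] StrongDual ℝ V} {ω : ℝ} (hω : 0 ≤ ω)
    (hb : ∀ v, 0 ≤ b v v + ω * ‖ι v‖ ^ 2) {z : Triple V H} (hz : IsPrimitive ι z)
    (h : evolutionOp V H b z = 0) : z = 0 := by
  rw [evolutionOp_apply, Prod.mk_eq_zero, add_eq_zero_iff_eq_neg] at h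
  obtain ⟨hg, hr0⟩ := h
  have hprim : ∀ t : Icc (0 : ℝ) 1, toDualV ι (z.2.2 t) = - b (∫ s in (0 : ℝ)..t, z.1 s) := by
    intro t
    rw [hz.primitive, hr0, map_zero, zero_add, ← b.intervalIntegral_comp_comm
      ((lp_intervalIntegrable z.1).mono_zero_one (by simp) t.2), ← primitiveCLM_apply, hg, map_neg,
      primitiveCLM_apply]
    congr 1
    exact intervalIntegral_congr_time (b.coeFn_compLpL (p := 2) z.1) (by simp) t.2
  have hy : z.1 = 0 := by
    refine forward_eq_zero hι hω hb ?_
    filter_upwards [hz.rep_ae, ae_time_mem] with t h1 ht v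
    rw [← h1 ht, ← toDualV_apply, hprim]
    rfl
  have hdt : z.2.1 = 0 := by rw [hg, hy, map_zero, neg_zero]
  have hrep : z.2.2 = 0 := by
    ext t
    have h1 : toDualV ι (z.2.2 t) = 0 := by
      rw [hz.primitive, hr0, map_zero, zero_add, ← primitiveCLM_apply, hdt, map_zero]
    refine hd.eq_zero_of_inner_left ℝ fun v => ?_
    rw [← toDualV_apply, h1]
    rfl
  exact Prod.ext hy (Prod.ext hdt hrep)

/-- A density result for `W(0,1)` obtained from well-posedness: solve inside the closure with the
same data, then conclude by uniqueness in the larger class. Any coercive operator will do; the Riesz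
map `D` has constants `1` and `0`. -/
theorem IsPrimitive.mem_evolutionSpace [CompleteSpace H] {ι : V →L[ℝ] H} (hι : Function.Injective ι)
    (hd : DenseRange ι) {z : Triple V H} (hz : IsPrimitive ι z) : z ∈ evolutionSpace ι := by
  set D : V →L[ℝ] StrongDual ℝ V := toDualV (ContinuousLinearMap.id ℝ V)
  have hD : ∀ v, D v v = ‖v‖ ^ 2 := fun v => real_inner_self_eq_norm_sq v
  obtain ⟨z', hz', he⟩ := evolutionOp_surjective hι hd (b := D) one_pos le_rfl
    (fun v => by simp [hD]) (evolutionOp V H D z)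
  have := (hz.sub (isPrimitive_of_mem hz')).eq_zero hι hd (b := D) le_rfl
    (fun v => by simp [hD]) (by rw [map_sub, he, sub_self])
  rwa [sub_eq_zero.1 this]

theorem integral_deriv_smul_primitive {E : Type*} [NormedAddCommGroup E] [NormedSpace ℝ E]
    [CompleteSpace E] {φ : ℝ → ℝ} (hφ : ContDiff ℝ (⊤ : ℕ∞) φ) (hs : tsupport φ ⊆ Ioo (0 : ℝ) 1)
    (c : E) (g : Lp E 2 timeMeasure) :
    ∫ t, deriv φ t • (c + ∫ s in (0 : ℝ)..t, g s) ∂timeMeasure =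
      - ∫ t, φ t • g t ∂timeMeasure := by
  have hφ' : Continuous (deriv φ) := hφ.continuous_deriv (by simp)
  have hz : ∀ t, t ∉ Ioo (0 : ℝ) 1 → φ t = 0 := fun t ht =>
    image_eq_zero_of_notMem_tsupport fun h => ht (hs h)
  have hftc : ∀ t, 0 + ∫ s in (0 : ℝ)..t, deriv φ s = φ t := by
    intro t
    rw [intervalIntegral.integral_deriv_eq_sub
      (fun s _ => (hφ.differentiable (by simp)).differentiableAt) (hφ'.intervalIntegrable _ _),
      hz 0 (by simp)]
    simp
  have key := bilin_primitive (ContinuousLinearMap.lsmul ℝ ℝ : ℝ →L[ℝ] E →L[ℝ] E)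
    (hφ'.intervalIntegrable 0 1) (lp_intervalIntegrable g) 0 c (t := 1) (by simp)
  simp only [hftc, ContinuousLinearMap.lsmul_apply, hz 1 (by simp), zero_smul, zero_add] at key
  rw [integral_timeMeasure, integral_timeMeasure, eq_neg_iff_add_eq_zero,
    ← intervalIntegral.integral_add]
  · exact key.symm
  · exact ContinuousOn.intervalIntegrable_of_Icc zero_le_one (hφ'.continuousOn.smul
      (continuousOn_const.add (continuousOn_primitive_Icc (lp_intervalIntegrable g))))
  · exact (lp_intervalIntegrable g).continuousOn_smul hφ.continuous.continuousOn

/-- The triple associated with an element of `W(0,1)`. -/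
def W.toTriple {ι : V →L[ℝ] H} (y : W ι) : Triple V H := (y.val, y.dt, y.rep)

-- By du Bois-Reymond, the continuous representative minus the primitive of the weak derivative is
-- constant in `V*`.
omit [CompleteSpace V] in
theorem W.isPrimitive {ι : V →L[ℝ] H} (y : W ι) : IsPrimitive ι y.toTriple := by
  refine ⟨y.rep_ae, ?_⟩
  set r : ℝ → H := IccExtend zero_le_one y.rep with hr
  have hrc : Continuous r := y.rep.continuous.Icc_extend'
  have hrt : ∀ t : Icc (0 : ℝ) 1, r t = y.rep t := fun t => by simp [hr]
  have hPc : ContinuousOn (fun t => 0 + ∫ s in (0 : ℝ)..t, y.dt s) (Icc 0 1) :=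
    continuousOn_const.add (continuousOn_primitive_Icc (lp_intervalIntegrable y.dt))
  have hTc : Continuous (fun t => toDualV ι (r t)) := (toDualV ι).continuous.comp hrc
  have key := eq_of_forall_integral_deriv_smul_eq_zero
    (F := fun t => toDualV ι (r t) - (0 + ∫ s in (0 : ℝ)..t, y.dt s))
    (hTc.continuousOn.sub hPc) (fun φ h1 h2 h3 => by
      have hφ' : Continuous (deriv φ) := h1.continuous_deriv (by simp)
      simp only [smul_sub]
      have e1 : Integrable (fun t => deriv φ t • toDualV ι (r t)) timeMeasure :=
        intervalIntegrable_zero_one_iff.1 ((hφ'.smul hTc).intervalIntegrable _ _)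
      have e2 : Integrable (fun t => deriv φ t • (0 + ∫ s in (0 : ℝ)..t, y.dt s)) timeMeasure :=
        intervalIntegrable_zero_one_iff.1
          (ContinuousOn.intervalIntegrable_of_Icc zero_le_one (hφ'.continuousOn.smul hPc))
      rw [integral_sub e1 e2, integral_deriv_smul_primitive h1 h3,
        ← y.hasWeakTimeDeriv φ h1 h2 h3, sub_eq_zero]
      refine integral_congr_ae ?_
      filter_upwards [y.rep_ae, ae_time_mem] with t h4 ht
      rw [← h4 ht, ← hrt])
  intro t
  have := key t t.2
  have h0 : r 0 = y.rep 0 := hrt 0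
  simp only [hrt, h0, zero_add, intervalIntegral.integral_same, sub_zero] at this
  exact (sub_eq_iff_eq_add.1 this)

omit [CompleteSpace V] in
theorem IsPrimitive.exists_W {ι : V →L[ℝ] H} {z : Triple V H} (hz : IsPrimitive ι z) :
    ∃ y : W ι, y.toTriple = z := by
  refine ⟨⟨z.1, z.2.1, z.2.2, fun φ h1 h2 h3 => ?_, hz.rep_ae⟩, rfl⟩
  rw [← integral_deriv_smul_primitive h1 h3 (toDualV ι (z.2.2 0))]
  refine integral_congr_ae ?_
  filter_upwards [hz.rep_ae, ae_time_mem] with t h4 ht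
  have := hz.primitive ⟨t, ht⟩
  rw [h4 ht] at this
  rw [this]

end Solvability

end MinDistance

namespace MinDistance
open Filter Topology

/-! ### Infima of parametrised functions under quadratic growth. -/

section ValueFunction

/-- A parametrised minimisation problem near the parameter `x₀`: the functions `f · u` have the
derivatives `F · u`, which are uniformly Lipschitz continuous and depend on `u` in a Lipschitz
way with respect to `N`, and `u₀` is a minimiser for `x₀` with quadratic growth. -/
structure GrowthFamily {A : Type*} (f F : ℝ → A → ℝ) (N : A → ℝ) (u₀ : A)
    (x₀ ρ L κ : ℝ) : Prop where
  L_nonneg : 0 ≤ L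
  κ_pos : 0 < κ
  N_nonneg : ∀ u, 0 ≤ N u
  bddBelow : ∀ x, BddBelow (range (f x))
  hasDerivAt : ∀ x ∈ Ioo (x₀ - ρ) (x₀ + ρ), ∀ u, HasDerivAt (fun x => f x u) (F x u) x
  lipschitz : ∀ x ∈ Ioo (x₀ - ρ) (x₀ + ρ), ∀ y ∈ Ioo (x₀ - ρ) (x₀ + ρ), ∀ u,
    |F x u - F y u| ≤ L * |x - y|
  dep : ∀ x ∈ Ioo (x₀ - ρ) (x₀ + ρ), ∀ u, |F x u - F x u₀| ≤ L * N u
  growth : ∀ u, κ * N u ^ 2 ≤ f x₀ u - f x₀ u₀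

theorem abs_sub_le_of_hasDerivAt {g g' : ℝ → ℝ} {s : Set ℝ} {C : ℝ} (hs : Convex ℝ s)
    (hg : ∀ x ∈ s, HasDerivAt g (g' x) x) (hC : ∀ x ∈ s, |g' x| ≤ C) {x y : ℝ}
    (hx : x ∈ s) (hy : y ∈ s) : |g y - g x| ≤ C * |y - x| :=
  hs.norm_image_sub_le_of_norm_hasDerivWithin_le (fun x hx => (hg x hx).hasDerivWithinAt) hC hx hy

namespace GrowthFamily

variable {A : Type*} {f F : ℝ → A → ℝ} {N : A → ℝ} {u₀ : A} {x₀ ρ L κ : ℝ}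

/-- Each `F(x, u) - L x` is nonincreasing in `x`, so every shifted member is concave, and an infimum
of concave functions is concave. -/
theorem concaveOn (h : GrowthFamily f F N u₀ x₀ ρ L κ) :
    ConcaveOn ℝ (Ioo (x₀ - ρ) (x₀ + ρ)) fun x => sInf (range (f x)) - L / 2 * x ^ 2 := by
  have hne : ∀ x, (range (f x)).Nonempty := fun x => ⟨_, u₀, rfl⟩
  have hd : ∀ u, ∀ x ∈ Ioo (x₀ - ρ) (x₀ + ρ),
      HasDerivAt (fun x => f x u - L / 2 * x ^ 2) (F x u - L * x) x := fun u x hx => by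
    have := (h.hasDerivAt x hx u).sub (((hasDerivAt_id x).pow 2).const_mul (L / 2))
    refine this.congr_deriv ?_
    simp only [id, Nat.cast_ofNat, Nat.add_one_sub_one, pow_one]
    ring
  have hu : ∀ u, ConcaveOn ℝ (Ioo (x₀ - ρ) (x₀ + ρ)) fun x => f x u - L / 2 * x ^ 2 := by
    intro u
    refine AntitoneOn.concaveOn_of_deriv (convex_Ioo _ _)
      (fun x hx => (hd u x hx).continuousAt.continuousWithinAt) ?_ ?_
    · rw [interior_Ioo]
      exact fun x hx => (hd u x hx).differentiableAt.differentiableWithinAt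
    · rw [interior_Ioo]
      intro x hx y hy hxy
      rw [(hd u x hx).deriv, (hd u y hy).deriv]
      have := (abs_le.1 (h.lipschitz x hx y hy u)).1
      rw [abs_of_nonpos (sub_nonpos.2 hxy)] at this
      linarith
  refine ⟨convex_Ioo _ _, fun x hx y hy a b ha hb hab => ?_⟩
  rw [le_sub_iff_add_le]
  refine le_csInf (hne _) ?_
  rintro _ ⟨u, rfl⟩
  have := (hu u).2 hx hy ha hb hab
  have h1 := csInf_le (h.bddBelow x) (mem_range_self u)
  have h2 := csInf_le (h.bddBelow y) (mem_range_self u)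
  have h3 := mul_le_mul_of_nonneg_left h1 ha
  have h4 := mul_le_mul_of_nonneg_left h2 hb
  simp only [smul_eq_mul] at this ⊢
  linarith

theorem differentiableWithinAt (h : GrowthFamily f F N u₀ x₀ ρ L κ) {x : ℝ}
    (hx : x ∈ Ioo (x₀ - ρ) (x₀ + ρ)) :
    DifferentiableWithinAt ℝ (fun x => sInf (range (f x))) (Iic x) x ∧
    DifferentiableWithinAt ℝ (fun x => sInf (range (f x))) (Ici x) x := by
  have hconv := h.concaveOn.neg
  have hx' : x ∈ interior (Ioo (x₀ - ρ) (x₀ + ρ)) := by rwa [interior_Ioo]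
  have key : ∀ s : Set ℝ, DifferentiableWithinAt ℝ
      (-fun x => sInf (range (f x)) - L / 2 * x ^ 2) s x →
      DifferentiableWithinAt ℝ (fun x => sInf (range (f x))) s x := by
    intro s hs
    have hq : DifferentiableWithinAt ℝ (fun x : ℝ => L / 2 * x ^ 2) s x := by fun_prop
    refine (hq.sub hs).congr (fun y _ => ?_) ?_ <;> simp
  have h1 := hconv.differentiableWithinAt_Iio_of_mem_interior hx'
  have h2 := hconv.differentiableWithinAt_Ioi_of_mem_interior hx'
  exact ⟨key _ (hasDerivWithinAt_Iio_iff_Iic.1 h1.hasDerivWithinAt).differentiableWithinAt,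
    key _ (hasDerivWithinAt_Ioi_iff_Ici.1 h2.hasDerivWithinAt).differentiableWithinAt⟩

/-- The excess `f(·, u) - f(·, u₀)` has derivative at most `L * N u`, so it is small at `x₀` if `u`
is nearly optimal at `x`. Growth then yields `κ N² ≤ L M N + κ e²`; measuring the slack as `κ * e ^
2` makes it contribute exactly `e`. -/
theorem N_le (h : GrowthFamily f F N u₀ x₀ ρ L κ) {x M e : ℝ} (hM : M < ρ)
    (hx : |x - x₀| ≤ M) (he : 0 < e) {u : A} (hu : f x u ≤ sInf (range (f x)) + κ * e ^ 2) :
    N u ≤ L * M / κ + e := by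
  have hκ := h.κ_pos
  have hM0 : 0 ≤ M := (abs_nonneg _).trans hx
  have hsub : ∀ y ∈ Icc (x₀ - M) (x₀ + M), y ∈ Ioo (x₀ - ρ) (x₀ + ρ) := fun y hy =>
    ⟨by linarith [hy.1], by linarith [hy.2]⟩
  have hx' : x ∈ Icc (x₀ - M) (x₀ + M) := by
    have := abs_le.1 hx
    exact ⟨by linarith, by linarith⟩
  have h1 := abs_sub_le_of_hasDerivAt (g := fun x => f x u - f x u₀) (convex_Icc _ _)
    (fun y hy => (h.hasDerivAt y (hsub y hy) u).sub (h.hasDerivAt y (hsub y hy) u₀))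
    (fun y hy => h.dep y (hsub y hy) u) hx' (y := x₀) ⟨by linarith, by linarith⟩
  have h2 := csInf_le (h.bddBelow x) (mem_range_self u₀)
  have h3 := h.growth u
  have h4 : L * N u * |x₀ - x| ≤ L * N u * M := by
    rw [abs_sub_comm]
    exact mul_le_mul_of_nonneg_left hx (mul_nonneg h.L_nonneg (h.N_nonneg u))
  have h5 : κ * N u ^ 2 ≤ L * N u * M + κ * e ^ 2 := by
    have := (le_abs_self _).trans h1
    linarith
  have hN := h.N_nonneg u
  by_contra hcon
  push Not at hcon
  have h6 : L * M + κ * e < κ * N u := by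
    have := mul_lt_mul_of_pos_left hcon hκ
    rw [mul_add, mul_div_cancel₀ _ hκ.ne'] at this
    exact this
  have hLM : 0 ≤ L * M := mul_nonneg h.L_nonneg hM0
  have h7 : e < N u := by
    have : 0 ≤ L * M / κ := by positivity
    linarith
  have h8 : (L * M + κ * e) * N u < κ * N u * N u := mul_lt_mul_of_pos_right h6 (he.trans h7)
  have h9 : κ * e * e < κ * e * N u := mul_lt_mul_of_pos_left h7 (by positivity)
  nlinarith

/-- A near-minimiser for `x` competes at `y`. By `N_le` its derivative stays within `O(M)` of `F x₀
u₀` along the segment. Near-minimisers with slack tending to zero avoid any existence question away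
from `x₀`. -/
theorem sub_le (h : GrowthFamily f F N u₀ x₀ ρ L κ) {x y M : ℝ} (hM : M < ρ)
    (hx : |x - x₀| ≤ M) (hy : |y - x₀| ≤ M) :
    sInf (range (f y)) - sInf (range (f x)) - F x₀ u₀ * (y - x) ≤
      (L * L / κ + L) * M * |y - x| := by
  have hκ := h.κ_pos
  have hM0 : 0 ≤ M := (abs_nonneg _).trans hx
  have hsub : ∀ y ∈ Icc (x₀ - M) (x₀ + M), y ∈ Ioo (x₀ - ρ) (x₀ + ρ) := fun y hy =>
    ⟨by linarith [hy.1], by linarith [hy.2]⟩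
  have hmem : ∀ {x}, |x - x₀| ≤ M → x ∈ Icc (x₀ - M) (x₀ + M) := fun hx => by
    have := abs_le.1 hx
    exact ⟨by linarith, by linarith⟩
  have hx0 : x₀ ∈ Icc (x₀ - M) (x₀ + M) := ⟨by linarith, by linarith⟩
  have main : ∀ e : ℝ, 0 < e → sInf (range (f y)) - sInf (range (f x)) - F x₀ u₀ * (y - x) ≤
      (L * (L * M / κ + e) + L * M) * |y - x| + κ * e ^ 2 := by
    intro e he
    obtain ⟨_, ⟨u, rfl⟩, hu⟩ := exists_lt_of_csInf_lt (s := range (f x)) ⟨_, u₀, rfl⟩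
      (b := sInf (range (f x)) + κ * e ^ 2) (by linarith [mul_pos hκ (pow_pos he 2)])
    have hN := h.N_le hM hx he hu.le
    have h1 := abs_sub_le_of_hasDerivAt (g := fun x => f x u - F x₀ u₀ * x)
      (g' := fun x => F x u - F x₀ u₀) (C := L * (L * M / κ + e) + L * M) (convex_Icc _ _)
      (fun y hy => by
        exact ((h.hasDerivAt y (hsub y hy) u).sub
          ((hasDerivAt_id y).const_mul (F x₀ u₀))).congr_deriv (by rw [mul_one]))
      (fun y hy => by
        have e1 := h.dep y (hsub y hy) u
        have e2 := h.lipschitz y (hsub y hy) x₀ (hsub x₀ hx0) u₀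
        have e3 : |y - x₀| ≤ M := abs_le.2 ⟨by linarith [hy.1], by linarith [hy.2]⟩
        have e4 := mul_le_mul_of_nonneg_left e3 h.L_nonneg
        have e5 := mul_le_mul_of_nonneg_left hN h.L_nonneg
        have e6 := abs_sub_le (F y u) (F y u₀) (F x₀ u₀)
        linarith) (hmem hx) (hmem hy)
    have h2 := csInf_le (h.bddBelow y) (mem_range_self u)
    have h3 := (le_abs_self _).trans h1
    linarith
  have hlim : Tendsto (fun e : ℝ => (L * (L * M / κ + e) + L * M) * |y - x| + κ * e ^ 2)
      (𝓝[>] 0) (𝓝 ((L * (L * M / κ + 0) + L * M) * |y - x| + κ * 0 ^ 2)) := by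
    have : Continuous fun e : ℝ => (L * (L * M / κ + e) + L * M) * |y - x| + κ * e ^ 2 := by
      fun_prop
    exact (this.tendsto 0).mono_left nhdsWithin_le_nhds
  have := ge_of_tendsto hlim (eventually_nhdsWithin_of_forall main)
  refine this.trans (le_of_eq ?_)
  ring

/-- The one-sided bound is symmetric in its hypotheses, so exchanging `x` and `y` supplies the lower
bound. -/
theorem abs_sub_le (h : GrowthFamily f F N u₀ x₀ ρ L κ) {x y : ℝ}
    (hx : x ∈ Ioo (x₀ - ρ) (x₀ + ρ)) (hy : y ∈ Ioo (x₀ - ρ) (x₀ + ρ)) :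
    |sInf (range (f y)) - sInf (range (f x)) - F x₀ u₀ * (y - x)| ≤
      (L * L / κ + L) * max |x - x₀| |y - x₀| * |y - x| := by
  have hM : max |x - x₀| |y - x₀| < ρ := max_lt
    (abs_lt.2 ⟨by linarith [hx.1], by linarith [hx.2]⟩)
    (abs_lt.2 ⟨by linarith [hy.1], by linarith [hy.2]⟩)
  have h1 := h.sub_le hM (le_max_left _ _) (le_max_right _ _)
  have h2 := h.sub_le hM (le_max_right _ _) (le_max_left _ _)
  rw [abs_sub_comm x y] at h2
  exact abs_le.2 ⟨by linarith, h1⟩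

theorem hasDerivAt_value (h : GrowthFamily f F N u₀ x₀ ρ L κ) (hρ : 0 < ρ) :
    HasDerivAt (fun x => sInf (range (f x))) (F x₀ u₀) x₀ := by
  rw [hasDerivAt_iff_isLittleO]
  have h1 : (fun x => sInf (range (f x)) - sInf (range (f x₀)) - (x - x₀) • F x₀ u₀)
      =O[𝓝 x₀] fun x => ‖x - x₀‖ ^ 2 := by
    refine Asymptotics.IsBigO.of_bound (L * L / κ + L) ?_
    filter_upwards [Ioo_mem_nhds (sub_lt_self x₀ hρ) (lt_add_of_pos_right x₀ hρ)] with x hx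
    have := h.abs_sub_le (x := x₀) ⟨by linarith, by linarith⟩ hx
    rw [sub_self, abs_zero, max_eq_right (abs_nonneg _)] at this
    rw [smul_eq_mul, mul_comm (x - x₀), Real.norm_eq_abs, Real.norm_eq_abs, Real.norm_eq_abs,
      abs_pow, abs_abs]
    linarith
  exact h1.trans_isLittleO (Asymptotics.isLittleO_pow_sub_sub x₀ one_lt_two)

/-- Dividing `abs_sub_le` by `|y - x|` and letting `y` tend to `x` from either side, the maximum
tends to `|x - x₀|`. -/
theorem abs_sub_le_of_isOneSidedDeriv (h : GrowthFamily f F N u₀ x₀ ρ L κ) {x d : ℝ}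
    (hx : x ∈ Ioo (x₀ - ρ) (x₀ + ρ))
    (hd : IsOneSidedDeriv (fun x => sInf (range (f x))) d x) :
    |d - F x₀ u₀| ≤ (L * L / κ + L) * |x - x₀| := by
  have key : ∀ l : Filter ℝ, l.NeBot → l ≤ 𝓝[≠] x →
      Tendsto (slope (fun x => sInf (range (f x))) x) l (𝓝 d) →
      |d - F x₀ u₀| ≤ (L * L / κ + L) * |x - x₀| := by
    intro l hl hlx hlim
    have hlx' : l ≤ 𝓝 x := hlx.trans nhdsWithin_le_nhds
    have h1 : Tendsto (fun y => (L * L / κ + L) * max |x - x₀| |y - x₀|) l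
        (𝓝 ((L * L / κ + L) * max |x - x₀| |x - x₀|)) := by
      have : Continuous fun y => (L * L / κ + L) * max |x - x₀| |y - x₀| := by fun_prop
      exact (this.tendsto x).mono_left hlx'
    rw [max_self] at h1
    refine le_of_tendsto_of_tendsto (hlim.sub_const (F x₀ u₀)).abs h1 ?_
    filter_upwards [hlx' (Ioo_mem_nhds hx.1 hx.2), hlx self_mem_nhdsWithin] with y hy hne
    have h2 := h.abs_sub_le hx hy
    have hne' : y - x ≠ 0 := sub_ne_zero.2 hne
    rw [← mul_le_mul_iff_left₀ (abs_pos.2 hne'), ← abs_mul]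
    refine le_trans (le_of_eq ?_) h2
    congr 1
    rw [slope_def_field]
    field_simp
  rcases hd with hd | hd
  · rw [hasDerivWithinAt_iff_tendsto_slope, Ici_sdiff_left] at hd
    exact key (𝓝[>] x) inferInstance (nhdsWithin_mono _ fun y hy => ne_of_gt hy) hd
  · rw [hasDerivWithinAt_iff_tendsto_slope, Iic_sdiff_right] at hd
    exact key (𝓝[<] x) inferInstance (nhdsWithin_mono _ fun y hy => ne_of_lt hy) hd

end GrowthFamily

end ValueFunction

end MinDistance

namespace MinDistance
open Filter Topology

/-! ### Right-hand sides measured in a weak norm. -/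

section Size

variable {V H : Type*}
  [NormedAddCommGroup V] [InnerProductSpace ℝ V] [CompleteSpace V]
  [NormedAddCommGroup H] [InnerProductSpace ℝ H]

/-- The norm of `y` in `C([0,1]; H) ∩ L²(I; V)`. -/
noncomputable def size (z : Triple V H) : ℝ := ‖z.2.2‖ + ‖z.1‖

omit [CompleteSpace V] in
theorem size_nonneg (z : Triple V H) : 0 ≤ size z := add_nonneg (norm_nonneg _) (norm_nonneg _)

omit [CompleteSpace V] in
theorem size_smul (c : ℝ) (z : Triple V H) : size (c • z) = |c| * size z := by
  simp only [size, Prod.smul_fst, Prod.smul_snd, norm_smul, Real.norm_eq_abs]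
  ring

omit [CompleteSpace V] in
theorem norm_rep_le_size (z : Triple V H) (t : Icc (0 : ℝ) 1) : ‖z.2.2 t‖ ≤ size z :=
  (z.2.2.norm_coe_le_norm t).trans (le_add_of_nonneg_right (norm_nonneg _))

omit [CompleteSpace V] in
theorem norm_compLpL_le_size (a : V →L[ℝ] StrongDual ℝ V) (z : Triple V H) :
    ‖a.compLpL 2 timeMeasure z.1‖ ≤ ‖a‖ * size z :=
  (ContinuousLinearMap.norm_compLp_le a z.1).trans
    (mul_le_mul_of_nonneg_left (le_add_of_nonneg_left (norm_nonneg _)) (norm_nonneg _))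

/-- The functional `G` on `C([0,1]; H) ∩ L²(I; V)` is bounded by `κ`, uniformly in the final
time. -/
def Dominated (ι : V →L[ℝ] H) (G : Lp (StrongDual ℝ V) 2 timeMeasure) (κ : ℝ) : Prop :=
  ∀ z ∈ evolutionSpace ι, ∀ t, pairing t G z.1 ≤ κ * size z

variable {ι : V →L[ℝ] H} {G G' : Lp (StrongDual ℝ V) 2 timeMeasure} {κ κ' : ℝ}

omit [CompleteSpace V] in
theorem dominated_norm (ι : V →L[ℝ] H) (G : Lp (StrongDual ℝ V) 2 timeMeasure) :
    Dominated ι G ‖G‖ := fun z _ t =>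
  (pairing_le t G z.1).trans
    (mul_le_mul_of_nonneg_left (le_add_of_nonneg_left (norm_nonneg _)) (norm_nonneg _))

omit [CompleteSpace V] in
theorem Dominated.mono (h : Dominated ι G κ) (hκ : κ ≤ κ') : Dominated ι G κ' :=
  fun z hz t => (h z hz t).trans (mul_le_mul_of_nonneg_right hκ (size_nonneg z))

omit [CompleteSpace V] in
theorem Dominated.add (h : Dominated ι G κ) (h' : Dominated ι G' κ') :
    Dominated ι (G + G') (κ + κ') := fun z hz t => by
  rw [map_add, add_apply, add_mul]
  exact add_le_add (h z hz t) (h' z hz t)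

omit [CompleteSpace V] in
theorem Dominated.smul (h : Dominated ι G κ) (c : ℝ) : Dominated ι (c • G) (|c| * κ) :=
  fun z hz t => by
    have := h (c • z) ((evolutionSpace ι).smul_mem c hz) t
    rw [size_smul, Prod.smul_fst, map_smul] at this
    rw [map_smul, smul_apply]
    linarith

omit [CompleteSpace V] in
theorem Dominated.sub (h : Dominated ι G κ) (h' : Dominated ι G' κ') :
    Dominated ι (G - G') (κ + κ') := by
  have := h.add (h'.smul (-1))
  rwa [neg_one_smul, ← sub_eq_add_neg, abs_neg, abs_one, one_mul] at this

theorem size_le {b : V →L[ℝ] StrongDual ℝ V} {α ω : ℝ} (hα : 0 < α) (hω : 0 ≤ ω) (hκ : 0 ≤ κ)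
    (hb : ∀ v, α * ‖v‖ ^ 2 ≤ b v v + ω * ‖ι v‖ ^ 2) {z : Triple V H} (hz : z ∈ evolutionSpace ι)
    (hG : Dominated ι (evolutionOp V H b z).1 κ) (h0 : ‖(evolutionOp V H b z).2‖ ≤ κ) :
    size z ≤ aprioriConst α ω * κ :=
  evolutionSpace_apriori hα hω hκ hb hz (fun t => hG z hz t) h0

end Size

/-! ### The state, its derivative in `ν`, and the equations for their increments. -/

namespace Problem

variable {V H Ω : Type*} [MeasurableSpace Ω] {ρ : Measure Ω}
  [NormedAddCommGroup V] [InnerProductSpace ℝ V] [CompleteSpace V]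
  [NormedAddCommGroup H] [InnerProductSpace ℝ H] [CompleteSpace H]
  (P : Problem V H ρ)

theorem exists_coercive {lo hi : ℝ} (hlo : 0 < lo) : ∃ α > 0, ∃ ω ≥ 0, ∀ ν ∈ Icc lo hi,
    ∀ v, α * ‖v‖ ^ 2 ≤ (ν • P.a) v v + ω * ‖P.ι v‖ ^ 2 := by
  obtain ⟨α₀, hα, ω₀, hω, h⟩ := P.garding
  -- The absolute value keeps the constant nonnegative even when the parameter interval is empty.
  refine ⟨lo * α₀, mul_pos hlo hα, |hi| * ω₀, by positivity, fun ν hν v => ?_⟩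
  have h1 := mul_le_mul_of_nonneg_left (h v) (hlo.le.trans hν.1)
  have h2 : lo * (α₀ * ‖v‖ ^ 2) ≤ ν * (α₀ * ‖v‖ ^ 2) :=
    mul_le_mul_of_nonneg_right hν.1 (by positivity)
  have h3 : ν * (ω₀ * ‖P.ι v‖ ^ 2) ≤ |hi| * (ω₀ * ‖P.ι v‖ ^ 2) :=
    mul_le_mul_of_nonneg_right (hν.2.trans (le_abs_self _)) (by positivity)
  simp only [smul_apply, smul_eq_mul]
  linarith

/-- The solution of `∂ₜ y + ν A y = G`, `y(0) = h` for the data `x = (G, h)`. -/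
noncomputable def sol (ν : ℝ) (x : Lp (StrongDual ℝ V) 2 timeMeasure × H) : Triple V H :=
  Classical.epsilon fun z => z ∈ evolutionSpace P.ι ∧ evolutionOp V H (ν • P.a) z = x

variable {ν ν' : ℝ}

theorem sol_spec (hν : 0 < ν) (x : Lp (StrongDual ℝ V) 2 timeMeasure × H) :
    P.sol ν x ∈ evolutionSpace P.ι ∧ evolutionOp V H (ν • P.a) (P.sol ν x) = x := by
  obtain ⟨α, hα, ω, hω, h⟩ := P.exists_coercive (hi := ν) hν
  obtain ⟨z, hz⟩ := evolutionOp_surjective P.ι_injective P.ι_denseRange hα hω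
    (h ν ⟨le_rfl, le_rfl⟩) x
  exact Classical.epsilon_spec (p := fun z => z ∈ evolutionSpace P.ι ∧
    evolutionOp V H (ν • P.a) z = x) ⟨z, hz⟩

theorem sol_mem (hν : 0 < ν) (x : Lp (StrongDual ℝ V) 2 timeMeasure × H) :
    P.sol ν x ∈ evolutionSpace P.ι := (P.sol_spec hν x).1

theorem evolutionOp_sol (hν : 0 < ν) (x : Lp (StrongDual ℝ V) 2 timeMeasure × H) :
    evolutionOp V H (ν • P.a) (P.sol ν x) = x := (P.sol_spec hν x).2

theorem eq_sol (hν : 0 < ν) {x : Lp (StrongDual ℝ V) 2 timeMeasure × H} {z : Triple V H}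
    (hz : z ∈ evolutionSpace P.ι) (h : evolutionOp V H (ν • P.a) z = x) : z = P.sol ν x := by
  obtain ⟨α, hα, ω, hω, hb⟩ := P.exists_coercive (hi := ν) hν
  have := (isPrimitive_of_mem ((evolutionSpace P.ι).sub_mem hz (P.sol_mem hν x))).eq_zero
    P.ι_injective P.ι_denseRange hω (b := ν • P.a)
    (fun v => (by positivity : 0 ≤ α * ‖v‖ ^ 2).trans (hb ν ⟨le_rfl, le_rfl⟩ v))
    (by rw [map_sub, h, P.evolutionOp_sol hν, sub_self])
  exact sub_eq_zero.1 this

theorem evolutionOp_smul_apply (z : Triple V H) : evolutionOp V H (ν • P.a) z =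
    (z.2.1 + ν • P.a.compLpL 2 timeMeasure z.1, z.2.2 0) := by
  rw [evolutionOp_apply, ContinuousLinearMap.smul_compLpL]
  rfl

theorem evolutionOp_change (z : Triple V H) : evolutionOp V H (ν • P.a) z =
    evolutionOp V H (ν' • P.a) z - ((ν' - ν) • P.a.compLpL 2 timeMeasure z.1, 0) := by
  rw [evolutionOp_smul_apply, evolutionOp_smul_apply, Prod.mk_sub_mk, sub_zero, sub_smul]
  congr 1
  abel

/-- The control operator acting on `U(0,1)`. -/
noncomputable abbrev BU : U ρ →L[ℝ] Lp (StrongDual ℝ V) 2 timeMeasure :=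
  P.B.compLpL 2 timeMeasure

theorem isState_iff (u : U ρ) (y : W P.ι) : P.IsState ν u y ↔
    evolutionOp V H (ν • P.a) y.toTriple = (ν • P.BU u, P.y0) := by
  have hae : ∀ᵐ t ∂timeMeasure,
      (y.dt + ν • P.a.compLpL 2 timeMeasure y.val : Lp (StrongDual ℝ V) 2 timeMeasure) t =
        y.dt t + ν • P.a (y.val t) ∧
      (ν • P.BU u : Lp (StrongDual ℝ V) 2 timeMeasure) t = ν • P.B (u t) := by
    filter_upwards [Lp.coeFn_add y.dt (ν • P.a.compLpL 2 timeMeasure y.val),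
      Lp.coeFn_smul ν (P.a.compLpL 2 timeMeasure y.val), P.a.coeFn_compLpL (p := 2) y.val,
      Lp.coeFn_smul ν (P.BU u), P.B.coeFn_compLpL (p := 2) u] with t h1 h2 h3 h4 h5
    rw [h1, Pi.add_apply, h2, Pi.smul_apply, h3, h4, Pi.smul_apply, h5]
    exact ⟨rfl, rfl⟩
  rw [evolutionOp_smul_apply, Prod.mk.injEq, IsState]
  refine and_congr ⟨fun h => ?_, fun h => ?_⟩ Iff.rfl
  · apply Lp.ext
    filter_upwards [h, hae] with t h1 h2
    exact h2.1.trans (h1.trans h2.2.symm)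
  · filter_upwards [hae] with t h2
    rw [← h2.1, ← h2.2]
    exact congrArg (fun g : Lp (StrongDual ℝ V) 2 timeMeasure => g t) h

/-- The state as a triple. -/
noncomputable def state (ν : ℝ) (u : U ρ) : Triple V H := P.sol ν (ν • P.BU u, P.y0)

/-- Every element of `W(0,1)` lies in the closure model, so the solution picked by choice must be
the unique one there. -/
theorem toTriple_S (hν : 0 < ν) (u : U ρ) : (P.S ν u).toTriple = P.state ν u := by
  obtain ⟨y, hy⟩ := (isPrimitive_of_mem (P.sol_mem hν (ν • P.BU u, P.y0))).exists_W
  have hS : P.IsState ν u (P.S ν u) := Classical.epsilon_spec (p := P.IsState ν u)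
    ⟨y, (P.isState_iff u y).2 (by rw [hy, P.evolutionOp_sol hν])⟩
  exact P.eq_sol hν ((P.S ν u).isPrimitive.mem_evolutionSpace P.ι_injective P.ι_denseRange)
    ((P.isState_iff u _).1 hS)

/-- The derivative of the state with respect to `ν`, as a triple. -/
noncomputable def stateDeriv (ν : ℝ) (u : U ρ) : Triple V H :=
  P.sol ν (P.BU u - P.a.compLpL 2 timeMeasure (P.state ν u).1, 0)

theorem f_eq (hν : 0 < ν) (u : U ρ) : P.f ν u = ‖(P.state ν u).2.2 1 - P.yd‖ - P.δ₀ := by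
  rw [f, ← P.toTriple_S hν]
  rfl

theorem state_mem (hν : 0 < ν) (u : U ρ) : P.state ν u ∈ evolutionSpace P.ι := P.sol_mem hν _

theorem stateDeriv_mem (hν : 0 < ν) (u : U ρ) : P.stateDeriv ν u ∈ evolutionSpace P.ι :=
  P.sol_mem hν _

theorem evolutionOp_state_sub (hν : 0 < ν) (hν' : 0 < ν') (u : U ρ) :
    evolutionOp V H (ν • P.a) (P.state ν' u - P.state ν u) =
      ((ν' - ν) • (P.BU u - P.a.compLpL 2 timeMeasure (P.state ν' u).1), 0) := by
  rw [map_sub, state, state, P.evolutionOp_sol hν, P.evolutionOp_change (ν' := ν'),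
    P.evolutionOp_sol hν', Prod.mk_sub_mk, Prod.mk_sub_mk, sub_zero, sub_self]
  congr 1
  module

/-- The first-order remainder solves the same equation with a right-hand side of second order in `ν'
- ν`, since the increment of the state is itself of first order. -/
theorem evolutionOp_remainder (hν : 0 < ν) (hν' : 0 < ν') (u : U ρ) :
    evolutionOp V H (ν • P.a) (P.state ν' u - P.state ν u - (ν' - ν) • P.stateDeriv ν u) =
      ((-(ν' - ν)) • P.a.compLpL 2 timeMeasure (P.state ν' u - P.state ν u).1, 0) := by
  rw [map_sub, P.evolutionOp_state_sub hν hν', map_smul, stateDeriv, P.evolutionOp_sol hν,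
    Prod.smul_mk, Prod.mk_sub_mk, smul_zero, sub_zero, ← smul_sub, Prod.fst_sub, map_sub,
    neg_smul, ← smul_neg]
  congr 2
  abel

theorem evolutionOp_stateDeriv_sub (hν : 0 < ν) (hν' : 0 < ν') (u : U ρ) :
    evolutionOp V H (ν • P.a) (P.stateDeriv ν' u - P.stateDeriv ν u) =
      ((-1 : ℝ) • P.a.compLpL 2 timeMeasure (P.state ν' u - P.state ν u).1 -
        (ν' - ν) • P.a.compLpL 2 timeMeasure (P.stateDeriv ν' u).1, 0) := by
  rw [map_sub, P.evolutionOp_change (ν' := ν')]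
  conv_lhs => rw [stateDeriv, stateDeriv, P.evolutionOp_sol hν, P.evolutionOp_sol hν']
  rw [Prod.mk_sub_mk, Prod.mk_sub_mk, sub_self, sub_zero, Prod.fst_sub, map_sub, neg_one_smul,
    ← stateDeriv]
  congr 1
  generalize P.BU u = x
  module

theorem evolutionOp_state_control (hν : 0 < ν) (u v : U ρ) :
    evolutionOp V H (ν • P.a) (P.state ν u - P.state ν v) = (ν • P.BU (u - v), 0) := by
  rw [map_sub, state, state, P.evolutionOp_sol hν, P.evolutionOp_sol hν, Prod.mk_sub_mk,
    sub_self, ← smul_sub, ← map_sub]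

theorem evolutionOp_stateDeriv_control (hν : 0 < ν) (u v : U ρ) :
    evolutionOp V H (ν • P.a) (P.stateDeriv ν u - P.stateDeriv ν v) =
      (P.BU (u - v) - P.a.compLpL 2 timeMeasure (P.state ν u - P.state ν v).1, 0) := by
  rw [map_sub, stateDeriv, stateDeriv, P.evolutionOp_sol hν, P.evolutionOp_sol hν, Prod.mk_sub_mk,
    sub_self, map_sub, Prod.fst_sub, map_sub]
  congr 1
  abel

end Problem

end MinDistance

namespace MinDistance
open Filter Topology

/-! ### Differentiating the norm and comparing unit vectors. -/

section Norm

variable {H : Type*} [NormedAddCommGroup H] [InnerProductSpace ℝ H]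

theorem hasDerivAt_norm {g : ℝ → H} {g' : H} {t : ℝ} (hg : HasDerivAt g g' t) (h : g t ≠ 0) :
    HasDerivAt (fun s => ‖g s‖) (inner ℝ (g t) g' / ‖g t‖) t := by
  have h1 := hg.norm_sq.sqrt (pow_ne_zero 2 (norm_ne_zero_iff.2 h))
  simp only [Real.sqrt_sq (norm_nonneg _)] at h1
  refine h1.congr_deriv ?_
  rw [mul_div_mul_left _ _ two_ne_zero]

theorem norm_unit_sub_le {x y : H} {ε : ℝ} (hε : 0 < ε) (hx : ε ≤ ‖x‖) (hy : ε ≤ ‖y‖) :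
    ‖‖x‖⁻¹ • x - ‖y‖⁻¹ • y‖ ≤ 2 / ε * ‖x - y‖ := by
  have hx0 : 0 < ‖x‖ := hε.trans_le hx
  have hy0 : 0 < ‖y‖ := hε.trans_le hy
  have h1 : ‖x‖⁻¹ • x - ‖y‖⁻¹ • y = ‖x‖⁻¹ • (x - y) + (‖x‖⁻¹ - ‖y‖⁻¹) • y := by
    module
  have h2 : |‖x‖⁻¹ - ‖y‖⁻¹| * ‖y‖ ≤ ‖x‖⁻¹ * ‖x - y‖ := by
    have : ‖x‖⁻¹ - ‖y‖⁻¹ = ‖x‖⁻¹ * (‖y‖ - ‖x‖) * ‖y‖⁻¹ := by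
      field_simp
    rw [this, abs_mul, abs_mul, abs_of_pos (inv_pos.2 hx0), abs_of_pos (inv_pos.2 hy0), mul_assoc,
      inv_mul_cancel₀ hy0.ne', mul_one, norm_sub_rev]
    exact mul_le_mul_of_nonneg_left (abs_norm_sub_norm_le y x) (inv_pos.2 hx0).le
  rw [h1]
  refine (norm_add_le _ _).trans ?_
  rw [norm_smul, norm_smul, Real.norm_eq_abs, Real.norm_eq_abs, abs_of_pos (inv_pos.2 hx0)]
  have h3 : ‖x‖⁻¹ * ‖x - y‖ ≤ ε⁻¹ * ‖x - y‖ := by gcongr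
  rw [div_mul_eq_mul_div, div_eq_mul_inv]
  linarith

theorem abs_inner_div_norm_sub_le {x y x' y' : H} {ε K d : ℝ} (hε : 0 < ε) (hx : ε ≤ ‖x‖)
    (hy : ε ≤ ‖y‖) (hx' : ‖x'‖ ≤ K) (h : ‖x - y‖ ≤ K * d) (h' : ‖x' - y'‖ ≤ K * d) :
    |inner ℝ x x' / ‖x‖ - inner ℝ y y' / ‖y‖| ≤ K * (1 + 2 / ε * K) * d := by
  have hy0 : 0 < ‖y‖ := hε.trans_le hy
  have h0 : ∀ x y : H, inner ℝ x y / ‖x‖ = inner ℝ (‖x‖⁻¹ • x) y := fun x y => by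
    rw [real_inner_smul_left]
    ring
  have h1 : inner ℝ x x' / ‖x‖ - inner ℝ y y' / ‖y‖ =
      inner ℝ (‖x‖⁻¹ • x - ‖y‖⁻¹ • y) x' + inner ℝ (‖y‖⁻¹ • y) (x' - y') := by
    rw [h0, h0, inner_sub_left, inner_sub_right]
    ring
  have h2 : ‖‖y‖⁻¹ • y‖ = 1 := by
    rw [norm_smul, norm_inv, norm_norm, inv_mul_cancel₀ hy0.ne']
  have h3 := abs_real_inner_le_norm (‖x‖⁻¹ • x - ‖y‖⁻¹ • y) x'
  have h4 := abs_real_inner_le_norm (‖y‖⁻¹ • y) (x' - y')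
  have hKd : 0 ≤ K * d := (norm_nonneg _).trans h
  have h5 : ‖‖x‖⁻¹ • x - ‖y‖⁻¹ • y‖ * ‖x'‖ ≤ (2 / ε * (K * d)) * K := by
    refine mul_le_mul ((norm_unit_sub_le hε hx hy).trans ?_) hx' (norm_nonneg _) (by positivity)
    exact mul_le_mul_of_nonneg_left h (by positivity)
  rw [h1]
  refine (abs_add_le _ _).trans ?_
  rw [h2, one_mul] at h4
  linarith

/-- The gradient inequality for the norm along a line. -/
theorem inner_div_norm_le (g w : H) : inner ℝ g w / ‖g‖ ≤ ‖g + w‖ - ‖g‖ := by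
  rcases eq_or_ne g 0 with rfl | hg
  · simp
  have hg0 := norm_pos_iff.2 hg
  rw [div_le_iff₀ hg0]
  have h1 := real_inner_le_norm g (g + w)
  rw [inner_add_right, real_inner_self_eq_norm_sq] at h1
  linarith

end Norm

/-! ### Bounds for the final state in the parameter and in the control. -/

namespace Problem

variable {V H Ω : Type*} [MeasurableSpace Ω] {ρ : Measure Ω}
  [NormedAddCommGroup V] [InnerProductSpace ℝ V] [CompleteSpace V]
  [NormedAddCommGroup H] [InnerProductSpace ℝ H] [CompleteSpace H]
  (P : Problem V H ρ)

/-- The final value `i₁ S(ν, u)`. -/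
noncomputable def fin (ν : ℝ) (u : U ρ) : H := (P.state ν u).2.2 1

/-- The derivative of the final value with respect to `ν`. -/
noncomputable def finDeriv (ν : ℝ) (u : U ρ) : H := (P.stateDeriv ν u).2.2 1

theorem exists_size_le {lo hi : ℝ} (hlo : 0 < lo) : ∃ C ≥ 0, ∀ ν ∈ Icc lo hi,
    ∀ z ∈ evolutionSpace P.ι, ∀ κ ≥ 0, Dominated P.ι (evolutionOp V H (ν • P.a) z).1 κ →
      ‖(evolutionOp V H (ν • P.a) z).2‖ ≤ κ → size z ≤ C * κ := by
  obtain ⟨α, hα, ω, hω, hb⟩ := P.exists_coercive (hi := hi) hlo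
  exact ⟨_, aprioriConst_nonneg hα hω, fun ν hν z hz κ hκ h1 h2 =>
    size_le hα hω hκ (hb ν hν) hz h1 h2⟩

/-- All increments solve evolution equations with zero initial value, so one a priori constant
handles them. The control enters only through `β`, hence `K` is uniform over controls with a common
weak bound. -/
theorem exists_parameter_bounds {lo hi β : ℝ} (hlo : 0 < lo) (hβ : 0 ≤ β) :
    ∃ K ≥ 0, ∀ u, Dominated P.ι (P.BU u) β → ∀ ν ∈ Icc lo hi, ∀ ν' ∈ Icc lo hi,
      ‖P.finDeriv ν u‖ ≤ K ∧ ‖P.fin ν' u - P.fin ν u‖ ≤ K * |ν' - ν| ∧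
      ‖P.finDeriv ν' u - P.finDeriv ν u‖ ≤ K * |ν' - ν| ∧
      ‖P.fin ν' u - P.fin ν u - (ν' - ν) • P.finDeriv ν u‖ ≤ K * |ν' - ν| ^ 2 := by
  obtain ⟨C, hC, hsize⟩ := P.exists_size_le (hi := hi) hlo
  set a := ‖P.a‖ with ha
  have ha0 : 0 ≤ a := norm_nonneg P.a
  -- `Y` bounds the states and `Z` their `ν`-derivatives; `Z` also serves as Lipschitz constant of
  -- the state, as the difference quotient has a right-hand side of the same form.
  set Y := C * (|hi| * β + ‖P.y0‖) with hY
  have hY0 : 0 ≤ Y := by positivity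
  set Z := C * (β + a * Y) with hZ
  have hZ0 : 0 ≤ Z := by positivity
  have hdom : ∀ z : Triple V H, Dominated P.ι (P.a.compLpL 2 timeMeasure z.1) (a * size z) :=
    fun z => (dominated_norm _ _).mono (norm_compLpL_le_size P.a z)
  refine ⟨Z + C * (a * Z) + C * (a * Z + a * Z), by positivity, fun u hu ν hν ν' hν' => ?_⟩
  have hp : ∀ {ν}, ν ∈ Icc lo hi → 0 < ν := fun h => hlo.trans_le h.1
  have hst : ∀ ν ∈ Icc lo hi, size (P.state ν u) ≤ Y := by
    intro ν hν
    refine hsize ν hν _ (P.state_mem (hp hν) u) _ (by positivity) ?_ ?_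
    · rw [state, P.evolutionOp_sol (hp hν)]
      refine (hu.smul ν).mono ?_
      rw [abs_of_pos (hp hν)]
      have := mul_le_mul_of_nonneg_right (hν.2.trans (le_abs_self hi)) hβ
      linarith [norm_nonneg P.y0]
    · rw [state, P.evolutionOp_sol (hp hν)]
      exact le_add_of_nonneg_left (by positivity)
  have hbu : ∀ ν ∈ Icc lo hi, Dominated P.ι
      (P.BU u - P.a.compLpL 2 timeMeasure (P.state ν u).1) (β + a * Y) := fun ν hν =>
    hu.sub ((hdom _).mono (mul_le_mul_of_nonneg_left (hst ν hν) ha0))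
  have hsd : ∀ ν ∈ Icc lo hi, size (P.stateDeriv ν u) ≤ Z := by
    intro ν hν
    refine hsize ν hν _ (P.stateDeriv_mem (hp hν) u) _ (by positivity) ?_ ?_
    · rw [stateDeriv, P.evolutionOp_sol (hp hν)]
      exact hbu ν hν
    · rw [stateDeriv, P.evolutionOp_sol (hp hν), norm_zero]
      positivity
  have hd0 := abs_nonneg (ν' - ν)
  have hdiff : size (P.state ν' u - P.state ν u) ≤ Z * |ν' - ν| := by
    refine (hsize ν hν _ ((evolutionSpace P.ι).sub_mem (P.state_mem (hp hν') u)
      (P.state_mem (hp hν) u)) (|ν' - ν| * (β + a * Y)) (by positivity) ?_ ?_).trans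
      (le_of_eq (by rw [hZ]; ring))
    · rw [P.evolutionOp_state_sub (hp hν) (hp hν')]
      exact (hbu ν' hν').smul _
    · rw [P.evolutionOp_state_sub (hp hν) (hp hν'), norm_zero]
      positivity
  have hdiff' := mul_le_mul_of_nonneg_left hdiff ha0
  have hrem : size (P.state ν' u - P.state ν u - (ν' - ν) • P.stateDeriv ν u) ≤
      C * (a * Z) * |ν' - ν| ^ 2 := by
    refine (hsize ν hν _ ((evolutionSpace P.ι).sub_mem ((evolutionSpace P.ι).sub_mem
      (P.state_mem (hp hν') u) (P.state_mem (hp hν) u)) ((evolutionSpace P.ι).smul_mem _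
      (P.stateDeriv_mem (hp hν) u))) (|ν' - ν| * (a * (Z * |ν' - ν|))) (by positivity) ?_ ?_).trans
      (le_of_eq (by ring))
    · rw [P.evolutionOp_remainder (hp hν) (hp hν')]
      have := ((hdom (P.state ν' u - P.state ν u)).mono hdiff').smul (-(ν' - ν))
      rwa [abs_neg] at this
    · rw [P.evolutionOp_remainder (hp hν) (hp hν'), norm_zero]
      positivity
  have hdd : size (P.stateDeriv ν' u - P.stateDeriv ν u) ≤
      C * (a * Z + a * Z) * |ν' - ν| := by
    refine (hsize ν hν _ ((evolutionSpace P.ι).sub_mem (P.stateDeriv_mem (hp hν') u)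
      (P.stateDeriv_mem (hp hν) u)) (|(-1 : ℝ)| * (a * (Z * |ν' - ν|)) + |ν' - ν| * (a * Z))
      (by positivity) ?_ ?_).trans (le_of_eq (by rw [abs_neg, abs_one]; ring))
    · rw [P.evolutionOp_stateDeriv_sub (hp hν) (hp hν')]
      exact (((hdom (P.state ν' u - P.state ν u)).mono hdiff').smul (-1)).sub
        (((hdom (P.stateDeriv ν' u)).mono
          (mul_le_mul_of_nonneg_left (hsd ν' hν') ha0)).smul (ν' - ν))
    · rw [P.evolutionOp_stateDeriv_sub (hp hν) (hp hν'), norm_zero]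
      positivity
  have c1 : 0 ≤ C * (a * Z) := by positivity
  have c2 : 0 ≤ C * (a * Z + a * Z) := by positivity
  refine ⟨?_, ?_, ?_, ?_⟩
  · refine (norm_rep_le_size _ 1).trans ((hsd ν hν).trans ?_)
    linarith
  · refine (norm_rep_le_size (P.state ν' u - P.state ν u) 1).trans (hdiff.trans ?_)
    gcongr
    linarith
  · refine (norm_rep_le_size (P.stateDeriv ν' u - P.stateDeriv ν u) 1).trans (hdd.trans ?_)
    gcongr
    linarith
  · refine (norm_rep_le_size (P.state ν' u - P.state ν u - (ν' - ν) • P.stateDeriv ν u) 1).trans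
      (hrem.trans ?_)
    gcongr
    linarith

theorem exists_control_bounds {lo hi : ℝ} (hlo : 0 < lo) :
    ∃ K ≥ 0, ∀ ν ∈ Icc lo hi, ∀ u v, ∀ n ≥ 0, Dominated P.ι (P.BU (u - v)) n →
      ‖P.fin ν u - P.fin ν v‖ ≤ K * n ∧ ‖P.finDeriv ν u - P.finDeriv ν v‖ ≤ K * n := by
  obtain ⟨C, hC, hsize⟩ := P.exists_size_le (hi := hi) hlo
  have ha0 := norm_nonneg P.a
  refine ⟨C * |hi| + C * (1 + ‖P.a‖ * (C * |hi|)), by positivity, fun ν hν u v n hn h => ?_⟩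
  have hp : 0 < ν := hlo.trans_le hν.1
  have h1 : size (P.state ν u - P.state ν v) ≤ C * |hi| * n := by
    refine (hsize ν hν _ ((evolutionSpace P.ι).sub_mem (P.state_mem hp u)
      (P.state_mem hp v)) (|hi| * n) (by positivity) ?_ ?_).trans (le_of_eq (by ring))
    · rw [P.evolutionOp_state_control hp]
      refine (h.smul ν).mono (mul_le_mul_of_nonneg_right ?_ hn)
      rw [abs_of_pos hp]
      exact hν.2.trans (le_abs_self _)
    · rw [P.evolutionOp_state_control hp, norm_zero]
      positivity
  have h2 : size (P.stateDeriv ν u - P.stateDeriv ν v) ≤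
      C * (1 + ‖P.a‖ * (C * |hi|)) * n := by
    refine (hsize ν hν _ ((evolutionSpace P.ι).sub_mem (P.stateDeriv_mem hp u)
      (P.stateDeriv_mem hp v)) (n + ‖P.a‖ * (C * |hi| * n)) (by positivity) ?_ ?_).trans
      (le_of_eq (by ring))
    · rw [P.evolutionOp_stateDeriv_control hp]
      exact h.sub ((dominated_norm _ _).mono ((norm_compLpL_le_size P.a _).trans
        (mul_le_mul_of_nonneg_left h1 ha0)))
    · rw [P.evolutionOp_stateDeriv_control hp, norm_zero]
      positivity
  have c1 : 0 ≤ C * |hi| * n := by positivity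
  have c2 : 0 ≤ C * (1 + ‖P.a‖ * (C * |hi|)) * n := by positivity
  constructor
  · refine (norm_rep_le_size (P.state ν u - P.state ν v) 1).trans (h1.trans ?_)
    linarith
  · refine (norm_rep_le_size (P.stateDeriv ν u - P.stateDeriv ν v) 1).trans (h2.trans ?_)
    linarith

theorem enorm_B_apply_le (B₁ : Lp ℝ 1 ρ →L[ℝ] H)
    (hB : ∀ (u₁ : Lp ℝ 1 ρ) (u₂ : Lp ℝ 2 ρ), u₁ =ᵐ[ρ] u₂ → toDualV P.ι (B₁ u₁) = P.B u₂)
    (w : Lp ℝ 2 ρ) (v : V) :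
    ‖P.B w v‖ₑ ≤ ENNReal.ofReal (‖B₁‖ + 1) * eLpNorm w 1 ρ * ‖P.ι v‖ₑ := by
  have hpos : ENNReal.ofReal (‖B₁‖ + 1) ≠ 0 := by
    rw [Ne, ENNReal.ofReal_eq_zero, not_le]
    positivity
  -- For infinite `L¹` norm the right-hand side is `∞` unless `v = 0`; the `+ 1` in the constant
  -- excludes the product `0 * ∞`.
  by_cases hw : eLpNorm w 1 ρ = ⊤
  · by_cases hv : v = 0
    · simp [hv]
    · have : ‖P.ι v‖ₑ ≠ 0 := by
        rw [enorm_ne_zero]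
        exact fun h => hv (P.ι_injective (h.trans (map_zero P.ι).symm))
      rw [hw, ENNReal.mul_top hpos, ENNReal.top_mul this]
      exact le_top
  · have hm : MemLp w 1 ρ := ⟨(Lp.memLp w).1, lt_top_iff_ne_top.2 hw⟩
    have h1 := hB hm.toLp w hm.coeFn_toLp
    have h2 : ‖P.B w v‖ ≤ (‖B₁‖ + 1) * ‖hm.toLp‖ * ‖P.ι v‖ := by
      rw [← h1, toDualV_apply]
      refine (abs_real_inner_le_norm _ _).trans ?_
      have := B₁.le_opNorm hm.toLp
      gcongr
      linarith [norm_nonneg hm.toLp]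
    calc ‖P.B w v‖ₑ = ENNReal.ofReal ‖P.B w v‖ := (ofReal_norm _).symm
      _ ≤ ENNReal.ofReal ((‖B₁‖ + 1) * ‖hm.toLp‖ * ‖P.ι v‖) := ENNReal.ofReal_le_ofReal h2
      _ = _ := by
        rw [ENNReal.ofReal_mul (by positivity), ENNReal.ofReal_mul (by positivity), ofReal_norm,
          ofReal_norm, Lp.enorm_toLp]

/-- On `L¹ ∩ L²`, `B` takes values in `H`, so the pairing needs only `ι y` in `H`, bounded uniformly
in time by the continuous representative; what remains is the time integral of the `L¹` norms. -/
theorem exists_dominated_l1 (hB : P.ControlOperatorL1H) : ∃ c ≥ 0, ∀ w : U ρ, l1Norm w ≠ ⊤ →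
    Dominated P.ι (P.BU w) (c * (l1Norm w).toReal) := by
  obtain ⟨B₁, hB₁⟩ := hB
  refine ⟨‖B₁‖ + 1, by positivity, fun w hw z hz t => ?_⟩
  set c := ENNReal.ofReal (‖B₁‖ + 1) with hc
  have hint : Integrable (fun s => (P.BU w) s (z.1 s)) timeMeasure :=
    integrable_bilin (ContinuousLinearMap.id ℝ (StrongDual ℝ V)) (P.BU w) z.1
  have h1 : pairing t (P.BU w) z.1 ≤ ∫ s, ‖(P.BU w) s (z.1 s)‖ ∂timeMeasure :=
    (le_abs_self _).trans (norm_intervalIntegral_le_integral_norm hint t.2)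
  have h2 : ∫⁻ s, ‖(P.BU w) s (z.1 s)‖ₑ ∂timeMeasure ≤ c * l1Norm w * ‖z.2.2‖ₑ := by
    have hle : ∫⁻ s, ‖(P.BU w) s (z.1 s)‖ₑ ∂timeMeasure ≤
        ∫⁻ s, c * eLpNorm (w s) 1 ρ * ‖z.2.2‖ₑ ∂timeMeasure := by
      refine lintegral_mono_ae ?_
      filter_upwards [P.B.coeFn_compLpL (p := 2) w, evolutionSpace_rep_ae hz, ae_time_mem]
        with s e1 e2 hs
      rw [e1]
      refine (P.enorm_B_apply_le B₁ hB₁ (w s) (z.1 s)).trans ?_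
      gcongr
      rw [← e2 hs, ← ofReal_norm, ← ofReal_norm]
      exact ENNReal.ofReal_le_ofReal (z.2.2.norm_coe_le_norm _)
    rwa [lintegral_mul_const' _ _ enorm_ne_top, lintegral_const_mul' _ _ ENNReal.ofReal_ne_top]
      at hle
  refine h1.trans ?_
  rw [integral_norm_eq_lintegral_enorm hint.1]
  calc _ ≤ (c * l1Norm w * ‖z.2.2‖ₑ).toReal :=
        ENNReal.toReal_mono (ENNReal.mul_ne_top (ENNReal.mul_ne_top ENNReal.ofReal_ne_top hw)
          enorm_ne_top) h2
    _ = (‖B₁‖ + 1) * (l1Norm w).toReal * ‖z.2.2‖ := by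
        rw [ENNReal.toReal_mul, ENNReal.toReal_mul, hc, ENNReal.toReal_ofReal (by positivity),
          toReal_enorm]
    _ ≤ _ := by
        have : ‖z.2.2‖ ≤ size z := le_add_of_nonneg_right (norm_nonneg _)
        gcongr

end Problem

end MinDistance

namespace MinDistance
open Filter Topology

/-! ### The minimal distance problem as a growth family. -/

namespace Problem

variable {V H Ω : Type*} [MeasurableSpace Ω] {ρ : Measure Ω}
  [NormedAddCommGroup V] [InnerProductSpace ℝ V] [CompleteSpace V]
  [NormedAddCommGroup H] [InnerProductSpace ℝ H] [CompleteSpace H]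
  (P : Problem V H ρ) {ν : ℝ}

/-- The final value of the solution as a continuous linear function of the data. -/
noncomputable def solFin (hν : 0 < ν) :
    Lp (StrongDual ℝ V) 2 timeMeasure × H →L[ℝ] H :=
  LinearMap.mkContinuousOfExistsBound
    { toFun := fun x => (P.sol ν x).2.2 1
      map_add' := fun x y => by
        rw [← P.eq_sol hν ((evolutionSpace P.ι).add_mem (P.sol_mem hν x) (P.sol_mem hν y))
          (by rw [map_add, P.evolutionOp_sol hν, P.evolutionOp_sol hν])]
        rfl
      map_smul' := fun c x => by
        rw [← P.eq_sol hν ((evolutionSpace P.ι).smul_mem c (P.sol_mem hν x))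
          (by rw [map_smul, P.evolutionOp_sol hν])]
        rfl }
    (by
      obtain ⟨C, -, h⟩ := P.exists_size_le (hi := ν) hν
      refine ⟨C, fun x => (norm_rep_le_size (P.sol ν x) 1).trans
        (h ν ⟨le_rfl, le_rfl⟩ _ (P.sol_mem hν x) _ (norm_nonneg x) ?_ ?_)⟩
      · rw [P.evolutionOp_sol hν]
        exact (dominated_norm _ _).mono (norm_fst_le x)
      · rw [P.evolutionOp_sol hν]
        exact norm_snd_le x)

theorem exists_fin_affine (hν : 0 < ν) :
    ∃ (Λ : U ρ →L[ℝ] H) (c : H), ∀ u, P.fin ν u = Λ u + c := by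
  refine ⟨(P.solFin hν).comp ((ν • P.BU).prod 0), P.solFin hν (0, P.y0), fun u => ?_⟩
  rw [ContinuousLinearMap.comp_apply, ← map_add]
  change (P.sol ν (ν • P.BU u, P.y0)).2.2 1 = (P.sol ν _).2.2 1
  simp

theorem f_eq_fin (hν : 0 < ν) (u : U ρ) : P.f ν u = ‖P.fin ν u - P.yd‖ - P.δ₀ := P.f_eq hν u

/-- The gradient inequality for the convex function `f(ν, ·)`. -/
theorem fderiv_f_le (hν : 0 < ν) {u : U ρ} (hu : P.fin ν u ≠ P.yd) (v : U ρ) :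
    fderiv ℝ (P.f ν) u (v - u) ≤ P.f ν v - P.f ν u := by
  obtain ⟨Λ, c, hΛ⟩ := P.exists_fin_affine hν
  have hf : P.f ν = fun u => ‖Λ u + c - P.yd‖ - P.δ₀ := funext fun u => by
    rw [P.f_eq_fin hν, hΛ]
  have hne : Λ u + c - P.yd ≠ 0 := by
    rw [← hΛ]
    exact sub_ne_zero.2 hu
  -- The final state misses `yd`, so the norm is differentiable there and `fderiv` is not its
  -- default value `0`.
  have hd : DifferentiableAt ℝ (P.f ν) u := by
    rw [hf]
    exact (((Λ.differentiableAt.add_const c).sub_const P.yd).norm ℝ hne).sub_const P.δ₀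
  have h1 : HasDerivAt (fun t : ℝ => P.f ν (u + t • (v - u))) (fderiv ℝ (P.f ν) u (v - u)) 0 :=
    hd.hasFDerivAt.hasLineDerivAt (v - u)
  have h2 : HasDerivAt (fun t : ℝ => P.f ν (u + t • (v - u)))
      (inner ℝ (Λ u + c - P.yd) (Λ (v - u)) / ‖Λ u + c - P.yd‖) 0 := by
    have e1 : HasDerivAt (fun t : ℝ => (Λ u + c - P.yd) + t • Λ (v - u)) (Λ (v - u)) 0 := by
      have := ((hasDerivAt_id (0 : ℝ)).smul_const (Λ (v - u))).const_add (Λ u + c - P.yd)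
      rwa [one_smul] at this
    have e2 := (hasDerivAt_norm e1 (by simpa using hne)).sub_const P.δ₀
    simp only [zero_smul, add_zero] at e2
    have heq : (fun t : ℝ => P.f ν (u + t • (v - u))) =
        fun t => ‖Λ u + c - P.yd + t • Λ (v - u)‖ - P.δ₀ := by
      funext t
      rw [hf]
      simp only [map_add, map_smul]
      congr 2
      abel
    rw [heq]
    exact e2
  rw [h1.unique h2, P.f_eq_fin hν, P.f_eq_fin hν, hΛ, hΛ]
  refine (inner_div_norm_le _ _).trans (le_of_eq ?_)
  rw [map_sub, show Λ u + c - P.yd + (Λ v - Λ u) = Λ v + c - P.yd by abel]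
  ring

theorem valueFun_eq : P.valueFun = fun ν => sInf (range fun u : P.UadTime => P.f ν u) := by
  funext ν
  rw [valueFun, image_eq_range]

theorem bddBelow_f (ν : ℝ) : BddBelow (range fun u : P.UadTime => P.f ν u) := by
  refine ⟨-P.δ₀, ?_⟩
  rintro _ ⟨u, rfl⟩
  simp only [f]
  linarith [norm_nonneg ((P.S ν u).rep 1 - P.yd)]

/-- The derivative of `f(·, u)`. -/
noncomputable def fDeriv (ν : ℝ) (u : U ρ) : ℝ :=
  inner ℝ (P.fin ν u - P.yd) (P.finDeriv ν u) / ‖P.fin ν u - P.yd‖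

theorem hasDerivAt_fin {lo hi K : ℝ} {u : U ρ} (hν : ν ∈ Ioo lo hi)
    (h : ∀ ν' ∈ Icc lo hi,
      ‖P.fin ν' u - P.fin ν u - (ν' - ν) • P.finDeriv ν u‖ ≤ K * |ν' - ν| ^ 2) :
    HasDerivAt (fun ν => P.fin ν u) (P.finDeriv ν u) ν := by
  rw [hasDerivAt_iff_isLittleO]
  have h1 : (fun x => P.fin x u - P.fin ν u - (x - ν) • P.finDeriv ν u)
      =O[𝓝 ν] fun x => ‖x - ν‖ ^ 2 := by
    refine Asymptotics.IsBigO.of_bound K ?_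
    filter_upwards [Icc_mem_nhds hν.1 hν.2] with x hx
    rw [norm_pow, norm_norm, Real.norm_eq_abs]
    exact h x hx
  exact h1.trans_isLittleO (Asymptotics.isLittleO_pow_sub_sub ν one_lt_two)

theorem hasDerivAt_f {u : U ρ} (hν : 0 < ν)
    (h : HasDerivAt (fun ν => P.fin ν u) (P.finDeriv ν u) ν) (hne : P.fin ν u ≠ P.yd) :
    HasDerivAt (fun ν => P.f ν u) (P.fDeriv ν u) ν := by
  have h1 := (hasDerivAt_norm (h.sub_const P.yd) (sub_ne_zero.2 hne)).sub_const P.δ₀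
  refine h1.congr_of_eventuallyEq ?_
  filter_upwards [Ioi_mem_nhds hν] with x hx
  exact P.f_eq_fin hx u

/-- Positive minimal distance at `ν₀` keeps all final states away from `yd` for nearby parameters,
so the norm is smooth along them; what must be secured is uniformity over admissible controls, which
carry no a priori `L²` bound. -/
theorem exists_growthFamily {ν₀ c₀ : ℝ} (hν₀ : 0 < ν₀) (hc₀ : 0 < c₀) {u₀ : U ρ}
    (hdist : -P.δ₀ < P.valueFun ν₀) (hopt : u₀ ∈ P.optimalControls ν₀)
    (hgrowth : P.GrowthCondition ν₀ u₀ c₀) (hB : P.ControlOperatorL1H) :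
    ∃ r > 0, r ≤ ν₀ ∧ ∃ L κ, GrowthFamily (fun ν (u : P.UadTime) => P.f ν u)
      (fun ν u => P.fDeriv ν u) (fun u => (l1Norm ((u : U ρ) - u₀)).toReal) ⟨u₀, hopt.1⟩
      ν₀ r L κ := by
  have hlo : 0 < ν₀ / 2 := half_pos hν₀
  have hmem : ν₀ ∈ Icc (ν₀ / 2) (2 * ν₀) := ⟨by linarith, by linarith⟩
  obtain ⟨cB, hcB, hdom⟩ := P.exists_dominated_l1 hB
  obtain ⟨K₁, hK₁, hctrl⟩ := P.exists_control_bounds (hi := 2 * ν₀) hlo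
  -- Half the minimal distance at `ν₀`: every final state stays `2 * ε` away from `yd` at `ν₀`, and
  -- `ε` is retained nearby.
  set ε := (P.valueFun ν₀ + P.δ₀) / 2 with hε
  have hε0 : 0 < ε := by
    rw [hε]
    linarith
  have hfar : ∀ u : P.UadTime, 2 * ε ≤ ‖P.fin ν₀ u - P.yd‖ := by
    intro u
    have h1 := csInf_le (P.bddBelow_f ν₀) (mem_range_self u)
    have h2 : P.valueFun ν₀ ≤ P.f ν₀ u := by
      rw [valueFun_eq]
      exact h1
    rw [P.f_eq_fin hν₀] at h2
    linarith
  have hne₀ : P.fin ν₀ u₀ ≠ P.yd := by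
    intro h
    have := hfar ⟨u₀, hopt.1⟩
    simp only [h, sub_self, norm_zero] at this
    linarith
  set κ := ν₀ * c₀ with hκ
  have hκ0 : 0 < κ := mul_pos hν₀ hc₀
  have hfin : ∀ u ∈ P.UadTime, l1Norm (u - u₀) ≠ ⊤ := by
    -- The right-hand side of the growth condition is finite, which rules out an infinite `L¹` norm.
    intro u hu htop
    have := hgrowth u hu
    rw [htop, ENNReal.top_pow two_ne_zero, ENNReal.mul_top
      (by rwa [Ne, ENNReal.ofReal_eq_zero, not_le])] at this
    exact ENNReal.ofReal_ne_top (top_le_iff.1 this)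
  have hquad : ∀ u ∈ P.UadTime,
      κ * (l1Norm (u - u₀)).toReal ^ 2 ≤ P.f ν₀ u - P.f ν₀ u₀ := by
    intro u hu
    have h1 := ENNReal.toReal_mono ENNReal.ofReal_ne_top (hgrowth u hu)
    rw [ENNReal.toReal_mul, ENNReal.toReal_pow, ENNReal.toReal_ofReal hκ0.le,
      ENNReal.toReal_ofReal'] at h1
    -- `ENNReal.ofReal` truncates a negative derivative to `0`; optimality of `u₀` covers that case.
    exact h1.trans (max_le (P.fderiv_f_le hν₀ hne₀ u) (sub_nonneg.2 (hopt.2 u hu)))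
  -- Quadratic growth against the linear upper bound `K₁ * cB * N` for the increase of `f ν₀` makes
  -- the admissible set bounded in `L¹` around `u₀`, hence all `P.BU u` uniformly dominated.
  set n₀ := K₁ * cB / κ with hn₀
  have hn₀0 : 0 ≤ n₀ := by positivity
  have hbdd : ∀ u ∈ P.UadTime, (l1Norm (u - u₀)).toReal ≤ n₀ := by
    intro u hu
    have hN : 0 ≤ (l1Norm (u - u₀)).toReal := ENNReal.toReal_nonneg
    have h1 := (hctrl ν₀ hmem u u₀ _ (mul_nonneg hcB hN) (hdom _ (hfin u hu))).1
    have h2 := hquad u hu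
    rw [P.f_eq_fin hν₀, P.f_eq_fin hν₀] at h2
    have h3 := norm_sub_norm_le (P.fin ν₀ u - P.yd) (P.fin ν₀ u₀ - P.yd)
    rw [sub_sub_sub_cancel_right] at h3
    rw [hn₀, le_div_iff₀ hκ0]
    rcases hN.eq_or_lt with h | h
    · rw [← h, zero_mul]
      positivity
    · refine le_of_mul_le_mul_right ?_ h
      linarith
  have hdomu : ∀ u ∈ P.UadTime, Dominated P.ι (P.BU u) (‖P.BU u₀‖ + cB * n₀) := by
    intro u hu
    have := (dominated_norm P.ι (P.BU u₀)).add ((hdom _ (hfin u hu)).mono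
      (mul_le_mul_of_nonneg_left (hbdd u hu) hcB))
    rwa [← map_add, add_sub_cancel] at this
  obtain ⟨K₂, hK₂, hpar⟩ := P.exists_parameter_bounds (hi := 2 * ν₀)
    (β := ‖P.BU u₀‖ + cB * n₀) hlo (by positivity)
  -- The first entry keeps `ν` inside the compact parameter interval; the second limits the drift of
  -- the final state to `ε`.
  set r := min (ν₀ / 2) (ε / (K₂ + 1)) with hr
  have hr0 : 0 < r := lt_min hlo (by positivity)
  have hr1 : r ≤ ν₀ / 2 := min_le_left _ _
  have hr2 : r * (K₂ + 1) ≤ ε := by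
    rw [← le_div_iff₀ (by positivity)]
    exact min_le_right _ _
  have hsub : ∀ ν ∈ Ioo (ν₀ - r) (ν₀ + r), ν ∈ Ioo (ν₀ / 2) (2 * ν₀) := fun ν hν =>
    ⟨by linarith [hν.1], by linarith [hν.2]⟩
  have hfar' : ∀ ν ∈ Ioo (ν₀ - r) (ν₀ + r), ∀ u : P.UadTime, ε ≤ ‖P.fin ν u - P.yd‖ := by
    intro ν hν u
    have h1 := (hpar u (hdomu u u.2) ν₀ hmem ν (Ioo_subset_Icc_self (hsub ν hν))).2.1
    have h2 : |ν - ν₀| ≤ r := abs_le.2 ⟨by linarith [hν.1], by linarith [hν.2]⟩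
    have h3 := norm_sub_norm_le (P.fin ν₀ u - P.yd) (P.fin ν u - P.yd)
    rw [sub_sub_sub_cancel_right, norm_sub_rev (P.fin ν₀ u) (P.fin ν u)] at h3
    have h4 := mul_le_mul_of_nonneg_left h2 hK₂
    have h5 := hfar u
    linarith
  set K := K₁ * cB + K₂ with hK
  have hK1c : 0 ≤ K₁ * cB := mul_nonneg hK₁ hcB
  refine ⟨r, hr0, by linarith, K * (1 + 2 / ε * K), κ, ?_⟩
  refine ⟨by positivity, hκ0, fun u => ENNReal.toReal_nonneg, P.bddBelow_f, ?_, ?_, ?_,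
    fun u => hquad u u.2⟩
  · intro ν hν u
    have hνp : 0 < ν := hlo.trans (hsub ν hν).1
    refine P.hasDerivAt_f hνp (P.hasDerivAt_fin (hsub ν hν) fun ν' hν' =>
      (hpar u (hdomu u u.2) ν (Ioo_subset_Icc_self (hsub ν hν)) ν' hν').2.2.2) fun h => ?_
    have := hfar' ν hν u
    rw [h, sub_self, norm_zero] at this
    linarith
  · intro ν hν ν' hν' u
    obtain ⟨h1, h2, h3, -⟩ := hpar u (hdomu u u.2) ν' (Ioo_subset_Icc_self (hsub ν' hν')) ν
      (Ioo_subset_Icc_self (hsub ν hν))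
    obtain ⟨h1', -⟩ := hpar u (hdomu u u.2) ν (Ioo_subset_Icc_self (hsub ν hν)) ν'
      (Ioo_subset_Icc_self (hsub ν' hν'))
    have hKd : K₂ * |ν - ν'| ≤ K * |ν - ν'| :=
      mul_le_mul_of_nonneg_right (by linarith) (abs_nonneg _)
    refine abs_inner_div_norm_sub_le hε0 (hfar' ν hν u) (hfar' ν' hν' u) (by linarith) ?_
      (h3.trans hKd)
    rw [sub_sub_sub_cancel_right]
    exact h2.trans hKd
  · intro ν hν u
    have hN : 0 ≤ (l1Norm ((u : U ρ) - u₀)).toReal := ENNReal.toReal_nonneg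
    obtain ⟨h2, h3⟩ := hctrl ν (Ioo_subset_Icc_self (hsub ν hν)) u u₀ _ (mul_nonneg hcB hN)
      (hdom _ (hfin u u.2))
    obtain ⟨h1, -⟩ := hpar u (hdomu u u.2) ν (Ioo_subset_Icc_self (hsub ν hν)) ν
      (Ioo_subset_Icc_self (hsub ν hν))
    have hKd : K₁ * (cB * (l1Norm ((u : U ρ) - u₀)).toReal) ≤
        K * (l1Norm ((u : U ρ) - u₀)).toReal := by
      rw [← mul_assoc]
      exact mul_le_mul_of_nonneg_right (by linarith) hN
    refine abs_inner_div_norm_sub_le hε0 (hfar' ν hν u) (hfar' ν hν ⟨u₀, hopt.1⟩) (by linarith) ?_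
      (h3.trans hKd)
    rw [sub_sub_sub_cancel_right]
    exact h2.trans hKd

end Problem

end MinDistance

/-- Both one-sided derivatives are compared with the slope `D` at `ν_bar`. As `ν₁ ≤ ν_bar ≤ ν₂`, the
two distances to `ν_bar` sum to `|ν₁ - ν₂|`. -/
theorem mainTheorem11 {V H Ω : Type*} [MeasurableSpace Ω] {ρ : Measure Ω}
    [NormedAddCommGroup V] [InnerProductSpace ℝ V] [CompleteSpace V]
    [NormedAddCommGroup H] [InnerProductSpace ℝ H] [CompleteSpace H]
    (P : MinDistance.Problem V H ρ)
    (ν_bar : ℝ) (u_bar : MinDistance.U ρ)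
    (h_dist : -P.δ₀ < P.valueFun ν_bar)
    (h_single : P.optimalControls ν_bar = {u_bar})
    (c₀ : ℝ) (hc₀ : 0 < c₀) (h_growth : P.GrowthCondition ν_bar u_bar c₀)
    (ν_min ν_max c_stab : ℝ) (h_min_pos : 0 < ν_min)
    (h_min : ν_min < ν_bar) (h_max : ν_bar < ν_max)
    (h_stab : P.AdjointStability ν_min ν_max c_stab)
    (hB : P.ControlOperatorL1H) :
    ∃ r : ℝ, 0 < r ∧ r < ν_bar ∧ ∃ c : ℝ, 0 < c ∧
      (∀ ν ∈ Icc (ν_bar - r) (ν_bar + r),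
        DifferentiableWithinAt ℝ P.valueFun (Iic ν) ν ∧
        DifferentiableWithinAt ℝ P.valueFun (Ici ν) ν) ∧
      DifferentiableAt ℝ P.valueFun ν_bar ∧
      (∀ ν₁ ∈ Icc (ν_bar - r) ν_bar, ∀ ν₂ ∈ Icc ν_bar (ν_bar + r), ∀ d₁ d₂ : ℝ,
        MinDistance.IsOneSidedDeriv P.valueFun d₁ ν₁ →
        MinDistance.IsOneSidedDeriv P.valueFun d₂ ν₂ →
        |d₁ - d₂| ≤ c * |ν₁ - ν₂|) ∧
      (∀ ν₁ ∈ Icc (ν_bar - r) ν_bar, ∀ ν₂ ∈ Icc ν_bar (ν_bar + r),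
        DifferentiableAt ℝ P.valueFun ν₁ → DifferentiableAt ℝ P.valueFun ν₂ →
        |deriv P.valueFun ν₁ - deriv P.valueFun ν₂| ≤ c * |ν₁ - ν₂|) := by
  have hopt : u_bar ∈ P.optimalControls ν_bar := by
    rw [h_single]
    rfl
  obtain ⟨R, hR, hRν, L, κ, hfam⟩ := P.exists_growthFamily (h_min_pos.trans h_min) hc₀ h_dist hopt
    h_growth hB
  set D := P.fDeriv ν_bar u_bar with hD
  have hL := hfam.L_nonneg
  have hκ := hfam.κ_pos
  have key : ∀ ν₁ ∈ Icc (ν_bar - R / 2) ν_bar, ∀ ν₂ ∈ Icc ν_bar (ν_bar + R / 2), ∀ d₁ d₂ : ℝ,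
      MinDistance.IsOneSidedDeriv P.valueFun d₁ ν₁ →
      MinDistance.IsOneSidedDeriv P.valueFun d₂ ν₂ →
      |d₁ - d₂| ≤ (L * L / κ + L + 1) * |ν₁ - ν₂| := by
    intro ν₁ h₁ ν₂ h₂ d₁ d₂ hd₁ hd₂
    rw [P.valueFun_eq] at hd₁ hd₂
    have e1 : |d₁ - D| ≤ (L * L / κ + L) * |ν₁ - ν_bar| := hfam.abs_sub_le_of_isOneSidedDeriv
      ⟨by linarith [h₁.1], by linarith [h₁.2]⟩ hd₁
    have e2 : |d₂ - D| ≤ (L * L / κ + L) * |ν₂ - ν_bar| := hfam.abs_sub_le_of_isOneSidedDeriv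
      ⟨by linarith [h₂.1], by linarith [h₂.2]⟩ hd₂
    rw [abs_of_nonpos (by linarith [h₁.2] : ν₁ - ν_bar ≤ 0)] at e1
    rw [abs_of_nonneg (by linarith [h₂.1] : 0 ≤ ν₂ - ν_bar), abs_sub_comm d₂] at e2
    rw [abs_of_nonpos (by linarith [h₁.2, h₂.1] : ν₁ - ν₂ ≤ 0)]
    have e3 := abs_sub_le d₁ D d₂
    have e4 : 0 ≤ ν₂ - ν₁ := by linarith [h₁.2, h₂.1]
    linarith
  -- Halving `R` places the closed interval inside the open one of the growth family; the `+ 1`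
  -- makes the constant positive even if `L = 0`.
  refine ⟨R / 2, half_pos hR, by linarith, L * L / κ + L + 1, by positivity, ?_, ?_, key, ?_⟩
  · intro ν hν
    rw [P.valueFun_eq]
    exact hfam.differentiableWithinAt ⟨by linarith [hν.1], by linarith [hν.2]⟩
  · rw [P.valueFun_eq]
    exact (hfam.hasDerivAt_value hR).differentiableAt
  · intro ν₁ h₁ ν₂ h₂ hd₁ hd₂
    exact key ν₁ h₁ ν₂ h₂ _ _ (Or.inl hd₁.hasDerivAt.hasDerivWithinAt)
      (Or.inl hd₂.hasDerivAt.hasDerivWithinAt)
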